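/- **Setting.** Let $x_L<x_R$ and let $\sigma_T,\sigma_S:[x_L,x_R]\to\mathbb R$ be measurable with $0<c\le\sigma_T\le C$ and $\sigma_S\ge 0$, such that $\lambda:=\|\sigma_S/\sigma_T\|_\infty\in(0,1)$; put $\sigma_r=\sigma_S/\lambda$. Let $L^2(\sigma_T)$ be the real Hilbert space with inner product $\langle f,g\rangle=\int_{x_L}^{x_R}fg\,\sigma_T\,dx$, and let $\|\cdot\|$ also denote the operator norm on it. For $0<|\mu|\le 1$ let $\mathcal A_\mu$ be the solution operator $\phi\mapsto\psi$ of $\mu\,\psi'+\sigma_T\psi=\sigma_r\phi$ on $[x_L,x_R]$ with zero inflow ($\psi(x_L)=0$ if $\mu>0$, $\psi(x_R)=0$ if $\mu<0$), that is, $(\mathcal A_\mu\phi)(x)=\int_{x_L}^{x_R}k_\mu(x,y)\phi(y)\sigma_T(y)\,dy$ with $$k_\mu(x,y)=\begin{cases}\frac1\mu\,\mathbb I_{(y\le x)}\,e^{-\frac1\mu\int_y^x\sigma_T(z)\,dz}\,\frac{\sigma_r(y)}{\sigma_T(y)}, & \mu>0,\\[2pt] -\frac1\mu\,\mathbb I_{(y\ge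 x)}\,e^{\frac1\mu\int_x^y\sigma_T(z)\,dz}\,\frac{\sigma_r(y)}{\sigma_T(y)}, & \mu<0.\end{cases}$$ Let $0\le\delta<1$ and $S=[-1,-\delta)\cup(\delta,1]$ (the case $\delta=0$ is the untruncated velocity space). Let $m\ge 1$, $n=2m$, let $S_1,\dots,S_m$ be a partition of $[-1,-\delta)$ into measurable cells of positive length, and let $S_{n+1-\ell}=-S_\ell$ for $1\le\ell\le m$. Let $\mu_1,\dots,\mu_m$ be independent random variables, $\mu_\ell$ uniformly distributed on $S_\ell$, and let $\mu_{n+1-\ell}=-\mu_\ell$ for $1\le\ell\le m$. Put $\alpha_\ell=n|S_\ell|/|S|$ and $$\mathcal T=\frac1{|S|}\int_S\mathcal A_\mu\,d\mu,\quad \mathcal T^\xi=\frac1n\sum_{\ell=1}^n\alpha_\ell\mathcal A_{\mu_\ell},\quad \mathcal T_\ell^\xi=\alpha_\ell\mathcal A_{\mu_\ell},\quad \mathcal T_\ell=\frac{\alpha_\ell}{|S_\ell|}\int_{S_\ell}\mathcal A_\mu\,d\mu,$$ $$\delta\mathcal T^\xi=\mathcal T^\xi-\mathcal T,\qquad \delta\mathcal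 T_\ell^\xi=\tfrac12\left(\mathcal T_\ell^\xi-\mathcal T_\ell+\mathcal T_{n+1-\ell}^\xi-\mathcal T_{n+1-\ell}\right)\quad(1\le\ell\le m).$$ **Theorem.** One has $\delta\mathcal T^\xi=\frac1m\sum_{\ell=1}^m\delta\mathcal T_\ell^\xi$; almost surely all the operators $(\delta\mathcal T_\ell^\xi)^*\delta\mathcal T_\ell^\xi$, $1\le\ell\le m$, are of trace class; the random variables under the two expectations below are integrable; and $$\mathbb E\left(\|\delta\mathcal T^\xi\|^2\right)\le 8\,\mathbb E\left[\left(\log\frac{m^{-1}\sum_{\ell=1}^m\operatorname{tr}\left((\delta\mathcal T_\ell^\xi)^*\delta\mathcal T_\ell^\xi\right)}{m^{-1}\sum_{\ell=1}^m\|\delta\mathcal T_\ell^\xi\|^2}+2.7\right)\frac1{m^2}\sum_{\ell=1}^m\|\delta\mathcal T_\ell^\xi\|^2\right],$$ where the expression in square brackets is read as $0$ when $\sum_{\ell=1}^m\|\delta\mathcal T_\ell^\xi\|^2=0$. -/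

import Mathlib

open MeasureTheory ProbabilityTheory Set
open scoped ENNReal

noncomputable section

namespace RandomOrdinate

/-! ### The trace of a positive operator -/

section Trace

variable {H : Type*} [NormedAddCommGroup H] [InnerProductSpace ℝ H] [CompleteSpace H]

/-- The index set of a fixed orthonormal basis of `H`. -/
def basisSet (H : Type*) [NormedAddCommGroup H] [InnerProductSpace ℝ H] [CompleteSpace H] :
    Set H :=
  Classical.choose (exists_hilbertBasis ℝ H)

/-- A fixed orthonormal basis of `H`. -/
def stdBasis (H : Type*) [NormedAddCommGroup H] [InnerProductSpace ℝ H] [CompleteSpace H] :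
    HilbertBasis (basisSet H) ℝ H :=
  Classical.choose (Classical.choose_spec (exists_hilbertBasis ℝ H))

/-- The trace `∑ i, ⟪e i, A (e i)⟫ ∈ [0, ∞]` of a positive operator `A`; the operator is of trace
class if and only if this is finite. For `A = T* T` it does not depend on the orthonormal basis, see
`posTrace_adjoint_comp_self`. -/
def posTrace (A : H →L[ℝ] H) : ℝ≥0∞ :=
  ∑' i, ENNReal.ofReal (inner ℝ (stdBasis H i) (A (stdBasis H i)))

theorem ofReal_norm_sq_eq_tsum {ι : Type*} (b : HilbertBasis ι ℝ H) (x : H) :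
    ENNReal.ofReal (‖x‖ ^ 2) = ∑' i, ENNReal.ofReal ((inner ℝ (b i) x) ^ 2) := by
  have h := b.hasSum_inner_mul_inner x x
  have h' : HasSum (fun i => (inner ℝ (b i) x) ^ 2) (‖x‖ ^ 2) := by
    rw [real_inner_self_eq_norm_sq] at h
    have he : (fun i => (inner ℝ (b i) x) ^ 2) = fun i => inner ℝ x (b i) * inner ℝ (b i) x :=
      funext fun i => by rw [real_inner_comm (b i) x, sq]
    rw [he]
    exact h
  rw [← h'.tsum_eq, ENNReal.ofReal_tsum_of_nonneg (fun i => sq_nonneg _) h'.summable]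

theorem tsum_sq_eq_adjoint {ι κ : Type*} (b : HilbertBasis ι ℝ H) (c : HilbertBasis κ ℝ H)
    (T : H →L[ℝ] H) :
    ∑' i, ENNReal.ofReal (‖T (b i)‖ ^ 2) =
      ∑' j, ENNReal.ofReal (‖ContinuousLinearMap.adjoint T (c j)‖ ^ 2) := by
  simp_rw [ofReal_norm_sq_eq_tsum c (T (b _)),
    ofReal_norm_sq_eq_tsum b (ContinuousLinearMap.adjoint T (c _))]
  rw [ENNReal.tsum_comm]
  refine tsum_congr fun j => tsum_congr fun i => ?_
  rw [ContinuousLinearMap.adjoint_inner_right, real_inner_comm]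

/-- The trace of `T* T` is the squared Hilbert-Schmidt norm of `T` in any orthonormal basis. -/
theorem posTrace_adjoint_comp_self {ι : Type*} (b : HilbertBasis ι ℝ H) (T : H →L[ℝ] H) :
    posTrace (ContinuousLinearMap.adjoint T ∘L T) = ∑' i, ENNReal.ofReal (‖T (b i)‖ ^ 2) := by
  have h : posTrace (ContinuousLinearMap.adjoint T ∘L T) =
      ∑' i, ENNReal.ofReal (‖T (stdBasis H i)‖ ^ 2) := by
    refine tsum_congr fun i => ?_
    rw [ContinuousLinearMap.comp_apply, ContinuousLinearMap.adjoint_inner_right,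
      real_inner_self_eq_norm_sq]
  rw [h, tsum_sq_eq_adjoint (stdBasis H) b, ← tsum_sq_eq_adjoint b b]

end Trace

/-! ### The medium and the solution operators -/

/-- A slab `[xL, xR]` with total and scattering cross sections `sigmaT`, `sigmaS`, where `sigmaT` is
bounded and bounded away from zero, and the essential supremum of `sigmaS / sigmaT` lies strictly
between 0 and 1. Only the values of the cross sections on `[xL, xR]` matter. -/
structure Slab where
  xL : ℝ
  xR : ℝ
  xL_lt_xR : xL < xR
  sigmaT : ℝ → ℝ
  sigmaS : ℝ → ℝ
  measurable_sigmaT : Measurable sigmaT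
  measurable_sigmaS : Measurable sigmaS
  sigmaT_lower : ∃ c : ℝ, 0 < c ∧ ∀ x ∈ Icc xL xR, c ≤ sigmaT x
  sigmaT_upper : ∃ C : ℝ, ∀ x ∈ Icc xL xR, sigmaT x ≤ C
  sigmaS_nonneg : ∀ x ∈ Icc xL xR, 0 ≤ sigmaS x
  ratio_pos : 0 < eLpNorm (fun x => sigmaS x / sigmaT x) ∞ (volume.restrict (Icc xL xR))
  ratio_lt_one : eLpNorm (fun x => sigmaS x / sigmaT x) ∞ (volume.restrict (Icc xL xR)) < 1

namespace Slab

variable (M : Slab)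

/-- `λ = ‖sigmaS / sigmaT‖_∞`. -/
def lam : ℝ :=
  (eLpNorm (fun x => M.sigmaS x / M.sigmaT x) ∞ (volume.restrict (Icc M.xL M.xR))).toReal

/-- `sigma_r = sigmaS / λ`. -/
def sigmaR (x : ℝ) : ℝ := M.sigmaS x / M.lam

/-- The measure `sigmaT(x) dx` on `[xL, xR]`. -/
def weight : Measure ℝ :=
  (volume.restrict (Icc M.xL M.xR)).withDensity (fun x => ENNReal.ofReal (M.sigmaT x))

/-- The real Hilbert space `L²([xL, xR]; sigmaT)`. -/
abbrev L2 : Type := Lp ℝ 2 M.weight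

/-- The kernel of the solution operator of `μ ψ' + sigmaT ψ = sigmaR φ` with zero inflow, with
respect to the measure `sigmaT(y) dy`. The value at `μ = 0` is irrelevant. -/
def kernel (μ x y : ℝ) : ℝ :=
  if 0 < μ then
    if y ≤ x then
      1 / μ * Real.exp (-(1 / μ) * ∫ z in y..x, M.sigmaT z) * (M.sigmaR y / M.sigmaT y)
    else 0
  else if μ < 0 then
    if x ≤ y then
      -(1 / μ) * Real.exp (1 / μ * ∫ z in x..y, M.sigmaT z) * (M.sigmaR y / M.sigmaT y)
    else 0
  else 0

theorem lam_pos : 0 < M.lam :=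
  ENNReal.toReal_pos M.ratio_pos.ne' (M.ratio_lt_one.trans ENNReal.one_lt_top).ne

instance isFiniteMeasure_weight : IsFiniteMeasure M.weight := by
  obtain ⟨C, hC⟩ := M.sigmaT_upper
  refine isFiniteMeasure_withDensity ?_
  have h : ∫⁻ x in Icc M.xL M.xR, ENNReal.ofReal (M.sigmaT x)
      ≤ ∫⁻ _ in Icc M.xL M.xR, ENNReal.ofReal C :=
    setLIntegral_mono measurable_const fun x hx => ENNReal.ofReal_le_ofReal (hC x hx)
  refine (h.trans_lt ?_).ne
  simp [ENNReal.mul_lt_top]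

theorem ae_weight_of_ae {p : ℝ → Prop} (h : ∀ᵐ x ∂(volume.restrict (Icc M.xL M.xR)), p x) :
    ∀ᵐ x ∂M.weight, p x :=
  (withDensity_absolutelyContinuous _ _).ae_le h

theorem ae_mem : ∀ᵐ x ∂M.weight, x ∈ Icc M.xL M.xR :=
  M.ae_weight_of_ae (ae_restrict_mem measurableSet_Icc)

theorem ae_abs_ratio_le : ∀ᵐ y ∂M.weight, |M.sigmaR y / M.sigmaT y| ≤ 1 := by
  apply M.ae_weight_of_ae
  have h := ae_le_eLpNormEssSup (f := fun x => M.sigmaS x / M.sigmaT x)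
    (μ := volume.restrict (Icc M.xL M.xR))
  filter_upwards [h] with y hy
  rw [← eLpNorm_exponent_top] at hy
  have hfin := (M.ratio_lt_one.trans ENNReal.one_lt_top).ne
  have h1 := ENNReal.toReal_mono hfin hy
  rw [toReal_enorm, Real.norm_eq_abs] at h1
  have h2 : M.sigmaR y / M.sigmaT y = M.sigmaS y / M.sigmaT y / M.lam := by
    rw [sigmaR]; ring
  rw [h2, abs_div, abs_of_pos M.lam_pos]
  exact (div_le_one M.lam_pos).2 h1

/-- `sigmaT` cut off outside the slab; used only to prove measurability. -/
def cutT : ℝ → ℝ := (Icc M.xL M.xR).indicator M.sigmaT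

theorem integrable_cutT : Integrable M.cutT := by
  obtain ⟨C, hC⟩ := M.sigmaT_upper
  obtain ⟨c, hc, hc'⟩ := M.sigmaT_lower
  unfold cutT
  rw [integrable_indicator_iff measurableSet_Icc]
  refine Measure.integrableOn_of_bounded (M := C) (by simp) M.measurable_sigmaT.aestronglyMeasurable ?_
  filter_upwards [ae_restrict_mem measurableSet_Icc] with x hx
  rw [Real.norm_eq_abs, abs_of_pos (hc.trans_le (hc' x hx))]
  exact hC x hx

theorem integral_cutT {x y : ℝ} (hx : x ∈ Icc M.xL M.xR) (hy : y ∈ Icc M.xL M.xR) :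
    ∫ z in x..y, M.cutT z = ∫ z in x..y, M.sigmaT z := by
  refine intervalIntegral.integral_congr fun z hz => ?_
  exact indicator_of_mem (uIcc_subset_Icc hx hy hz) _

/-- A jointly measurable version of `kernel`; used only to prove measurability. -/
def cutKernel (μ x y : ℝ) : ℝ :=
  if 0 < μ then
    if y ≤ x then
      1 / μ * Real.exp (-(1 / μ) * ∫ z in y..x, M.cutT z) * (M.sigmaR y / M.sigmaT y)
    else 0
  else if μ < 0 then
    if x ≤ y then
      -(1 / μ) * Real.exp (1 / μ * ∫ z in x..y, M.cutT z) * (M.sigmaR y / M.sigmaT y)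
    else 0
  else 0

theorem cutKernel_eq {μ x y : ℝ} (hx : x ∈ Icc M.xL M.xR) (hy : y ∈ Icc M.xL M.xR) :
    M.cutKernel μ x y = M.kernel μ x y := by
  unfold cutKernel kernel
  rw [M.integral_cutT hx hy, M.integral_cutT hy hx]

theorem measurable_cutKernel : Measurable fun p : ℝ × ℝ × ℝ => M.cutKernel p.1 p.2.1 p.2.2 := by
  have hprim : Continuous fun x => ∫ z in (0 : ℝ)..x, M.cutT z :=
    intervalIntegral.continuous_primitive (fun a b => M.integrable_cutT.intervalIntegrable) 0
  obtain ⟨F, hF⟩ : ∃ F : ℝ → ℝ, F = fun x => ∫ z in (0 : ℝ)..x, M.cutT z := ⟨_, rfl⟩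
  rw [← hF] at hprim
  have hsub : ∀ x y : ℝ, ∫ z in x..y, M.cutT z = F y - F x := fun x y => by
    rw [hF]
    exact (intervalIntegral.integral_interval_sub_left M.integrable_cutT.intervalIntegrable
      M.integrable_cutT.intervalIntegrable).symm
  have hm := hprim.measurable
  have h1 := M.measurable_sigmaT
  have h2 : Measurable M.sigmaR := M.measurable_sigmaS.div_const _
  unfold cutKernel
  simp_rw [hsub]
  refine Measurable.ite (measurableSet_lt measurable_const (by fun_prop)) ?_ ?_
  · refine Measurable.ite (measurableSet_le (by fun_prop) (by fun_prop)) (by fun_prop)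
      measurable_const
  · refine Measurable.ite (measurableSet_lt (by fun_prop) measurable_const) ?_ measurable_const
    refine Measurable.ite (measurableSet_le (by fun_prop) (by fun_prop)) (by fun_prop)
      measurable_const

theorem abs_kernel_le {μ x y : ℝ} (hx : x ∈ Icc M.xL M.xR) (hy : y ∈ Icc M.xL M.xR)
    (hr : |M.sigmaR y / M.sigmaT y| ≤ 1) : |M.kernel μ x y| ≤ |1 / μ| := by
  obtain ⟨c, hc, hc'⟩ := M.sigmaT_lower
  have hint : ∀ {a b : ℝ}, a ∈ Icc M.xL M.xR → b ∈ Icc M.xL M.xR → a ≤ b →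
      0 ≤ ∫ z in a..b, M.sigmaT z := fun ha hb hab =>
    intervalIntegral.integral_nonneg hab fun z hz =>
      hc.le.trans (hc' z ⟨ha.1.trans hz.1, hz.2.trans hb.2⟩)
  have main : ∀ a e r : ℝ, |a| ≤ |1 / μ| → e ≤ 0 → |r| ≤ 1 →
      |a * Real.exp e * r| ≤ |1 / μ| := by
    intro a e r ha he hr
    rw [abs_mul, abs_mul, Real.abs_exp]
    have h1 := Real.exp_le_one_iff.2 he
    calc |a| * Real.exp e * |r| ≤ |1 / μ| * 1 * 1 := by gcongr
      _ = |1 / μ| := by ring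
  unfold kernel
  split_ifs with h1 h2 h3 h4
  · have := hint hy hx h2
    refine main _ _ _ le_rfl ?_ hr
    have h5 : 0 < 1 / μ := by positivity
    nlinarith [mul_nonneg h5.le this]
  · simp
  · have := hint hx hy h4
    refine main _ _ _ (by rw [abs_neg]) ?_ hr
    have h5 : 1 / μ < 0 := one_div_neg.2 h3
    exact mul_nonpos_of_nonpos_of_nonneg h5.le this
  · simp
  · simp

theorem integrable_kernel_mul (μ : ℝ) {x : ℝ} (hx : x ∈ Icc M.xL M.xR) {f : ℝ → ℝ}
    (hf : Integrable f M.weight) : Integrable (fun y => M.kernel μ x y * f y) M.weight := by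
  refine hf.bdd_mul (c := |1 / μ|) ?_ ?_
  · have h : Measurable fun y => M.cutKernel μ x y :=
      M.measurable_cutKernel.comp (by fun_prop : Measurable fun y : ℝ => (μ, x, y))
    refine h.aestronglyMeasurable.congr ?_
    filter_upwards [M.ae_mem] with y hy using M.cutKernel_eq hx hy
  · filter_upwards [M.ae_mem, M.ae_abs_ratio_le] with y hy hr
    exact M.abs_kernel_le hx hy hr

theorem integrable_coe (φ : M.L2) : Integrable φ M.weight :=
  (Lp.memLp φ).integrable (by norm_num)

theorem abs_integral_le (μ : ℝ) (φ : M.L2) {x : ℝ} (hx : x ∈ Icc M.xL M.xR) :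
    ‖∫ y, M.kernel μ x y * φ y ∂M.weight‖ ≤ |1 / μ| * ∫ y, ‖φ y‖ ∂M.weight := by
  rw [← integral_const_mul]
  refine norm_integral_le_of_norm_le ((M.integrable_coe φ).norm.const_mul _) ?_
  filter_upwards [M.ae_mem, M.ae_abs_ratio_le] with y hy hr
  rw [norm_mul]
  exact mul_le_mul_of_nonneg_right (M.abs_kernel_le hx hy hr) (norm_nonneg _)

theorem memLp_integral (μ : ℝ) (φ : M.L2) :
    MemLp (fun x => ∫ y, M.kernel μ x y * φ y ∂M.weight) 2 M.weight := by
  refine MemLp.of_bound (C := |1 / μ| * ∫ y, ‖φ y‖ ∂M.weight) ?_ ?_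
  · have h : StronglyMeasurable fun p : ℝ × ℝ => M.cutKernel μ p.1 p.2 * φ p.2 := by
      refine StronglyMeasurable.mul ?_ ?_
      · exact (M.measurable_cutKernel.comp
          (by fun_prop : Measurable fun p : ℝ × ℝ => (μ, p.1, p.2))).stronglyMeasurable
      · exact (Lp.stronglyMeasurable φ).comp_measurable measurable_snd
    refine (h.integral_prod_right' (ν := M.weight)).aestronglyMeasurable.congr ?_
    filter_upwards [M.ae_mem] with x hx
    refine integral_congr_ae ?_
    filter_upwards [M.ae_mem] with y hy
    simp only [M.cutKernel_eq hx hy]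
  · filter_upwards [M.ae_mem] with x hx using M.abs_integral_le μ φ hx

/-- The integral operator with kernel `kernel μ`, as a linear map. -/
def solLin (μ : ℝ) : M.L2 →ₗ[ℝ] M.L2 where
  toFun φ := (M.memLp_integral μ φ).toLp _
  map_add' φ ψ := by
    rw [← MemLp.toLp_add]
    refine MemLp.toLp_congr _ _ ?_
    filter_upwards [M.ae_mem] with x hx
    rw [Pi.add_apply, ← integral_add (M.integrable_kernel_mul μ hx (M.integrable_coe φ))
      (M.integrable_kernel_mul μ hx (M.integrable_coe ψ))]
    refine integral_congr_ae ?_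
    filter_upwards [Lp.coeFn_add φ ψ] with y hy
    rw [hy, Pi.add_apply, mul_add]
  map_smul' c φ := by
    rw [RingHom.id_apply, ← MemLp.toLp_const_smul]
    refine MemLp.toLp_congr _ _ ?_
    filter_upwards [M.ae_mem] with x hx
    rw [Pi.smul_apply, smul_eq_mul, ← integral_const_mul]
    refine integral_congr_ae ?_
    filter_upwards [Lp.coeFn_smul c φ] with y hy
    rw [hy, Pi.smul_apply, smul_eq_mul]
    ring

theorem exists_bound_solLin (μ : ℝ) : ∃ C : ℝ, ∀ φ : M.L2, ‖M.solLin μ φ‖ ≤ C * ‖φ‖ := by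
  have hL1 : ∀ φ : M.L2, ∫ y, ‖φ y‖ ∂M.weight ≤
      (M.weight univ ^ (1 / (1 : ℝ≥0∞).toReal - 1 / (2 : ℝ≥0∞).toReal)).toReal * ‖φ‖ := by
    intro φ
    have h1 := eLpNorm_le_eLpNorm_mul_rpow_measure_univ (p := 1) (q := 2) (by norm_num)
      (Lp.aestronglyMeasurable φ)
    have h2 : ∫ y, ‖φ y‖ ∂M.weight = (eLpNorm φ 1 M.weight).toReal := by
      rw [eLpNorm_one_eq_lintegral_enorm,
        integral_norm_eq_lintegral_enorm (Lp.aestronglyMeasurable φ)]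
    rw [h2, Lp.norm_def, mul_comm, ← ENNReal.toReal_mul]
    refine ENNReal.toReal_mono (ENNReal.mul_ne_top (Lp.eLpNorm_ne_top φ) ?_) h1
    exact ENNReal.rpow_ne_top_of_nonneg (by norm_num) (measure_ne_top _ _)
  set K := (M.weight univ ^ (1 / (1 : ℝ≥0∞).toReal - 1 / (2 : ℝ≥0∞).toReal)).toReal
  refine ⟨M.weight.real univ ^ ((2 : ℝ≥0∞).toReal⁻¹) * (|1 / μ| * K), fun φ => ?_⟩
  have hI : 0 ≤ ∫ y, ‖φ y‖ ∂M.weight := integral_nonneg fun _ => norm_nonneg _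
  have h := Lp.norm_le_of_ae_bound (f := M.solLin μ φ) (C := |1 / μ| * ∫ y, ‖φ y‖ ∂M.weight)
    (by positivity) (by
      filter_upwards [M.ae_mem, MemLp.coeFn_toLp (M.memLp_integral μ φ)] with x hx he
      change ‖((M.memLp_integral μ φ).toLp _ : M.L2) x‖ ≤ _
      rw [he]
      exact M.abs_integral_le μ φ hx)
  refine h.trans ?_
  have h3 := hL1 φ
  calc _ ≤ M.weight.real univ ^ ((2 : ℝ≥0∞).toReal⁻¹) * (|1 / μ| * (K * ‖φ‖)) := by
        gcongr
        exact le_rfl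
    _ = _ := by ring

/-- The solution operator `A_μ` on `L²([xL, xR]; sigmaT)`: the bounded integral operator
`(A_μ φ)(x) = ∫ kernel μ x y φ(y) sigmaT(y) dy`. -/
def solOp (μ : ℝ) : M.L2 →L[ℝ] M.L2 :=
  (M.solLin μ).mkContinuousOfExistsBound (M.exists_bound_solLin μ)

theorem coeFn_solOp (μ : ℝ) (φ : M.L2) :
    M.solOp μ φ =ᵐ[M.weight] fun x => ∫ y, M.kernel μ x y * φ y ∂M.weight :=
  MemLp.coeFn_toLp (M.memLp_integral μ φ)

end Slab

/-! ### The random ordinates and the random operators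

The velocity space is `S = [-1, -δ) ∪ (δ, 1]` with `0 ≤ δ < 1`. Its negative half `[-1, -δ)` is
divided into `m` cells and `n = m + m`. -/

/-- The velocity space `[-1, -δ) ∪ (δ, 1]`. -/
def velocity (δ : ℝ) : Set ℝ := Ico (-1) (-δ) ∪ Ioc δ 1

/-- `S` is a partition of `[-1, -δ)` into `m` measurable cells of positive length. -/
structure IsPartition {m : ℕ} (δ : ℝ) (S : Fin m → Set ℝ) : Prop where
  measurableSet : ∀ l, MeasurableSet (S l)
  pairwise_disjoint : Pairwise fun k l => Disjoint (S k) (S l)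
  iUnion_eq : ⋃ l, S l = Ico (-1) (-δ)
  volume_pos : ∀ l, 0 < volume (S l)

/-- All `n = 2m` cells: the cell number `n + 1 - l` is the mirror image of the cell number `l`. -/
def allCells {m : ℕ} (S : Fin m → Set ℝ) : Fin (m + m) → Set ℝ :=
  Fin.addCases S fun j => {μ | -μ ∈ S j.rev}

/-- All `n = 2m` ordinates: `μ_{m + l} = - μ_{m + 1 - l}` for `l = 1, …, m`. -/
def allOrdinates {m : ℕ} (u : Fin m → ℝ) : Fin (m + m) → ℝ :=
  Fin.addCases u fun j => -u j.rev

/-- The rescaled weights `α_l = n ω_l` with `ω_l = |S_l| / |S|`. -/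
def alpha {m : ℕ} (δ : ℝ) (S : Fin m → Set ℝ) (l : Fin (m + m)) : ℝ :=
  ((m + m : ℕ) : ℝ) * (volume.real (allCells S l) / volume.real (velocity δ))

section Operators

variable (M : Slab) {m : ℕ} (δ : ℝ) (S : Fin m → Set ℝ) (u : Fin m → ℝ)

/-- `T`, the average of `A_μ` over the velocity space. -/
def opT : M.L2 →L[ℝ] M.L2 := ⨍ μ in velocity δ, M.solOp μ

/-- `T_l^ξ = α_l A_{μ_l}`. -/
def opTCellXi (l : Fin (m + m)) : M.L2 →L[ℝ] M.L2 :=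
  alpha δ S l • M.solOp (allOrdinates u l)

/-- `T_l = α_l ⨍_{S_l} A_μ dμ`. -/
def opTCell (l : Fin (m + m)) : M.L2 →L[ℝ] M.L2 :=
  alpha δ S l • ⨍ μ in allCells S l, M.solOp μ

/-- `T^ξ = (1/n) ∑_l α_l A_{μ_l}`. -/
def opTXi : M.L2 →L[ℝ] M.L2 :=
  (1 / ((m + m : ℕ) : ℝ)) • ∑ l, alpha δ S l • M.solOp (allOrdinates u l)

/-- `δT^ξ = T^ξ - T`. -/
def deltaT : M.L2 →L[ℝ] M.L2 := opTXi M δ S u - opT M δ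

/-- `δT_l^ξ = (T_l^ξ - T_l + T_{n+1-l}^ξ - T_{n+1-l}) / 2` for `l = 1, …, m`. -/
def deltaTCell (l : Fin m) : M.L2 →L[ℝ] M.L2 :=
  (1 / 2 : ℝ) •
    (opTCellXi M δ S u (Fin.castAdd m l) - opTCell M δ S (Fin.castAdd m l)
      + opTCellXi M δ S u (Fin.castAdd m l).rev - opTCell M δ S (Fin.castAdd m l).rev)

/-- `tr ((δT_l^ξ)* δT_l^ξ) ∈ [0, ∞]`. -/
def traceCell (l : Fin m) : ℝ≥0∞ :=
  posTrace (ContinuousLinearMap.adjoint (deltaTCell M δ S u l) ∘L deltaTCell M δ S u l)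

end Operators

end RandomOrdinate

end

open RandomOrdinate

/-!
The operators `δT_l^ξ` are functions `cellOp l (μ_l)` of independent random ordinates, they are
centered because `μ_l` is uniform on its cell, and `δT^ξ` is their average. The bound combines two
inequalities.

* Symmetrization (`integral_norm_sum_sq_le`). For every choice of signs `ε`, the groups of summands
  with sign `1` and with sign `-1` are independent and centered. By Jensen's inequality each of the two
  partial sums is dominated in mean square by their difference `∑ ε_l X_l`, hence
  `E ‖∑ X_l‖² ≤ 4 E ‖∑ ε_l X_l‖²`.
* A Khintchine inequality with intrinsic dimension (`sum_norm_signedSum_sq_le`). For Hilbert-Schmidt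
  operators `B_l` with `v = ∑ ‖B_l‖²` and `t = ∑ tr (B_l* B_l)`, the average of `‖∑ ε_l B_l‖²` over all
  signs is at most `2 (log (t / v) + 2.7) v`. It suffices to treat compressions to finite-dimensional
  spaces and, after passing to block matrices, symmetric matrices `H_l`. There the moments
  `E tr (∑ ε_l H_l)^(2p)` are bounded by `(2p - 1)!! v^(p - 1) · 2 t`: expanding one factor and averaging
  over one sign leaves `tr ((A - C) (A^(r+1) - C^(r+1)))` with `A - C = 2 ε_l H_l`, which the spectral
  theorem reduces to a scalar inequality (`two_mul_trace_sub_mul_pow_sub_le`). The bound follows with `p`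
  close to `log (t / v) + log 2`.

The remaining statements concern the solution operators. In the optical depth variable the kernel of
`A_μ` is dominated by `a exp (-a |x - y|)` with `a = 1 / |μ|`. Hence `‖A_μ‖ ≤ 2` by Schur's test, and
the Hilbert-Schmidt norm of `A_μ` is of order `|μ|^(-1/2)`. Since this is integrable, the averages of
`A_μ` are Hilbert-Schmidt operators even if `δ = 0`, and since `v log (t / v) ≤ 2 (t v)^(1/2)`, the
right-hand side is integrable although `t` need not be. The measurability of `μ ↦ A_μ` comes from its
continuity in the operator norm away from `μ = 0`.
-/

namespace RandomOrdinate

open Matrix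

/-! ### Trace inequalities for symmetric matrices -/

/-- Each pair of mixed terms `a ^ i * c ^ (r - i)` and `a ^ (r - i) * c ^ i` is at most
`a ^ r + c ^ r`. -/
theorem two_mul_geom_sum₂_le {r : ℕ} (hr : Even r) (a c : ℝ) :
    2 * ∑ i ∈ Finset.range (r + 1), a ^ i * c ^ (r - i) ≤ (r + 1) * (a ^ r + c ^ r) := by
  have hrefl : ∑ i ∈ Finset.range (r + 1), a ^ i * c ^ (r - i) =
      ∑ i ∈ Finset.range (r + 1), a ^ (r - i) * c ^ i := by
    rw [← Finset.sum_range_reflect]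
    refine Finset.sum_congr rfl fun i hi => ?_
    have hi' := Finset.mem_range.1 hi
    rw [show r + 1 - 1 - i = r - i by omega, show r - (r - i) = i by omega]
  have hterm : ∀ i ∈ Finset.range (r + 1),
      a ^ i * c ^ (r - i) + a ^ (r - i) * c ^ i ≤ a ^ r + c ^ r := by
    intro i hi
    have hi' : i ≤ r := Nat.lt_succ_iff.1 (Finset.mem_range.1 hi)
    have h1 : a ^ i * c ^ (r - i) ≤ |a| ^ i * |c| ^ (r - i) := by
      rw [← abs_pow, ← abs_pow, ← abs_mul]; exact le_abs_self _
    have h2 : a ^ (r - i) * c ^ i ≤ |a| ^ (r - i) * |c| ^ i := by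
      rw [← abs_pow, ← abs_pow, ← abs_mul]; exact le_abs_self _
    have h3 : 0 ≤ (|a| ^ i - |c| ^ i) * (|a| ^ (r - i) - |c| ^ (r - i)) := by
      rcases le_total |a| |c| with h | h
      · exact mul_nonneg_of_nonpos_of_nonpos
          (sub_nonpos.2 (pow_le_pow_left₀ (abs_nonneg _) h _))
          (sub_nonpos.2 (pow_le_pow_left₀ (abs_nonneg _) h _))
      · exact mul_nonneg (sub_nonneg.2 (pow_le_pow_left₀ (abs_nonneg _) h _))
          (sub_nonneg.2 (pow_le_pow_left₀ (abs_nonneg _) h _))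
    have h4 : |a| ^ i * |a| ^ (r - i) = a ^ r := by
      rw [← pow_add, Nat.add_sub_cancel' hi', hr.pow_abs]
    have h5 : |c| ^ i * |c| ^ (r - i) = c ^ r := by
      rw [← pow_add, Nat.add_sub_cancel' hi', hr.pow_abs]
    nlinarith
  calc 2 * ∑ i ∈ Finset.range (r + 1), a ^ i * c ^ (r - i)
      = ∑ i ∈ Finset.range (r + 1), (a ^ i * c ^ (r - i) + a ^ (r - i) * c ^ i) := by
        rw [Finset.sum_add_distrib, ← hrefl, two_mul]
    _ ≤ ∑ _i ∈ Finset.range (r + 1), (a ^ r + c ^ r) := Finset.sum_le_sum hterm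
    _ = (r + 1) * (a ^ r + c ^ r) := by simp [mul_add]

/-- A quantitative mean value inequality for `a ↦ a ^ (r + 1)`, with the average of the derivatives at
the two end points. -/
theorem two_mul_sub_mul_pow_sub_le {r : ℕ} (hr : Even r) (a c : ℝ) :
    2 * ((a - c) * (a ^ (r + 1) - c ^ (r + 1))) ≤
      (r + 1) * ((a - c) ^ 2 * (a ^ r + c ^ r)) := by
  have h := geom_sum₂_mul a c (r + 1)
  have h' : ∀ i ∈ Finset.range (r + 1), a ^ i * c ^ (r + 1 - 1 - i) = a ^ i * c ^ (r - i) :=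
    fun i _ => by simp
  rw [Finset.sum_congr rfl h'] at h
  rw [← h]
  nlinarith [mul_le_mul_of_nonneg_left (two_mul_geom_sum₂_le hr a c) (sq_nonneg (a - c))]

section Matrices

variable {n : Type*} [Fintype n] [DecidableEq n]

theorem exists_pow_eq_of_isHermitian {A : Matrix n n ℝ} (hA : A.IsHermitian) :
    ∃ (U : Matrix n n ℝ) (a : n → ℝ), Uᵀ * U = 1 ∧ U * Uᵀ = 1 ∧
      ∀ p : ℕ, A ^ p = U * diagonal (fun i => a i ^ p) * Uᵀ := by
  have h1 : (hA.eigenvectorUnitary : Matrix n n ℝ)ᵀ * hA.eigenvectorUnitary = 1 :=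
    Unitary.coe_star_mul_self hA.eigenvectorUnitary
  have h2 : (hA.eigenvectorUnitary : Matrix n n ℝ) * (hA.eigenvectorUnitary : Matrix n n ℝ)ᵀ = 1 :=
    Unitary.coe_mul_star_self hA.eigenvectorUnitary
  refine ⟨hA.eigenvectorUnitary, hA.eigenvalues, h1, h2, fun p => ?_⟩
  have h := hA.spectral_theorem
  rw [Unitary.conjStarAlgAut_apply] at h
  have h3 : A = (hA.eigenvectorUnitary : Matrix n n ℝ) * diagonal hA.eigenvalues *
      (hA.eigenvectorUnitary : Matrix n n ℝ)ᵀ := h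
  generalize (hA.eigenvectorUnitary : Matrix n n ℝ) = U at *
  generalize hA.eigenvalues = a at *
  clear h
  induction p with
  | zero => simp [h2]
  | succ p ih =>
    rw [pow_succ, ih, h3]
    calc U * diagonal (fun i => a i ^ p) * Uᵀ * (U * diagonal a * Uᵀ)
        = U * diagonal (fun i => a i ^ p) * (Uᵀ * U) * diagonal a * Uᵀ := by
          simp only [Matrix.mul_assoc]
      _ = _ := by
          rw [h1, Matrix.mul_one, Matrix.mul_assoc U, diagonal_mul_diagonal]
          simp only [pow_succ]

/-- The traces of products of powers of two symmetric matrices are the integrals of the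
corresponding monomials over one and the same positive measure on pairs of eigenvalues. This reduces
trace inequalities to scalar ones. -/
theorem exists_trace_pow_mul_pow_eq {A C : Matrix n n ℝ} (hA : A.IsHermitian)
    (hC : C.IsHermitian) :
    ∃ (a c : n → ℝ) (w : n → n → ℝ), (∀ i j, 0 ≤ w i j) ∧
      ∀ p q : ℕ, (A ^ p * C ^ q).trace = ∑ i, ∑ j, w i j * (a i ^ p * c j ^ q) := by
  obtain ⟨U, a, -, -, hU⟩ := exists_pow_eq_of_isHermitian hA
  obtain ⟨V, c, -, -, hV⟩ := exists_pow_eq_of_isHermitian hC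
  refine ⟨a, c, fun i j => (Uᵀ * V) i j ^ 2, fun i j => sq_nonneg _, fun p q => ?_⟩
  rw [hU, hV]
  have : (U * diagonal (fun i => a i ^ p) * Uᵀ * (V * diagonal (fun i => c i ^ q) * Vᵀ)).trace =
      (diagonal (fun i => a i ^ p) * (Uᵀ * V) * (diagonal (fun i => c i ^ q) * (Uᵀ * V)ᵀ)).trace := by
    rw [transpose_mul, transpose_transpose, Matrix.mul_assoc U, Matrix.mul_assoc U,
      Matrix.trace_mul_comm]
    simp only [Matrix.mul_assoc]
  rw [this, Matrix.trace]
  refine Finset.sum_congr rfl fun i _ => ?_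
  rw [diag_apply, Matrix.mul_apply]
  refine Finset.sum_congr rfl fun j _ => ?_
  rw [diagonal_mul, diagonal_mul, transpose_apply]
  ring

/-- The trace version of `two_mul_sub_mul_pow_sub_le`. -/
theorem two_mul_trace_sub_mul_pow_sub_le {r : ℕ} (hr : Even r) {A C : Matrix n n ℝ}
    (hA : A.IsHermitian) (hC : C.IsHermitian) :
    2 * ((A - C) * (A ^ (r + 1) - C ^ (r + 1))).trace ≤
      (r + 1) * (((A - C) * (A - C) * A ^ r).trace + ((A - C) * (A - C) * C ^ r).trace) := by
  obtain ⟨a, c, w, hw, h⟩ := exists_trace_pow_mul_pow_eq hA hC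
  have hl : ((A - C) * (A ^ (r + 1) - C ^ (r + 1))).trace =
      ∑ i, ∑ j, w i j * ((a i - c j) * (a i ^ (r + 1) - c j ^ (r + 1))) := by
    have h1 : ((A - C) * (A ^ (r + 1) - C ^ (r + 1))).trace =
        (A ^ (r + 2) * C ^ 0).trace - (A ^ 1 * C ^ (r + 1)).trace
          - (A ^ (r + 1) * C ^ 1).trace + (A ^ 0 * C ^ (r + 2)).trace := by
      rw [sub_mul, mul_sub, mul_sub, trace_sub, trace_sub, trace_sub, ← pow_succ', ← pow_succ',
        Matrix.trace_mul_comm C (A ^ (r + 1))]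
      simp only [pow_zero, Matrix.mul_one, Matrix.one_mul, pow_one]
      ring
    rw [h1, h, h, h, h]
    simp only [← Finset.sum_sub_distrib, ← Finset.sum_add_distrib]
    refine Finset.sum_congr rfl fun i _ => Finset.sum_congr rfl fun j _ => ?_
    ring
  have hr1 : ((A - C) * (A - C) * A ^ r).trace =
      ∑ i, ∑ j, w i j * ((a i - c j) ^ 2 * a i ^ r) := by
    have h1 : ((A - C) * (A - C) * A ^ r).trace =
        (A ^ (r + 2) * C ^ 0).trace - (A ^ (r + 1) * C ^ 1).trace
          - (A ^ (r + 1) * C ^ 1).trace + (A ^ r * C ^ 2).trace := by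
      have e1 : (A * C * A ^ r).trace = (A ^ (r + 1) * C ^ 1).trace := by
        rw [Matrix.trace_mul_comm, ← Matrix.mul_assoc, ← pow_succ, pow_one]
      have e2 : (C * A * A ^ r).trace = (A ^ (r + 1) * C ^ 1).trace := by
        rw [Matrix.mul_assoc, Matrix.trace_mul_comm, ← pow_succ', pow_one]
      have e3 : (C * C * A ^ r).trace = (A ^ r * C ^ 2).trace := by
        rw [Matrix.trace_mul_comm, sq]
      have e4 : (A * A * A ^ r).trace = (A ^ (r + 2) * C ^ 0).trace := by
        rw [pow_zero, Matrix.mul_one, ← sq, ← pow_add, add_comm]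
      rw [sub_mul, mul_sub, mul_sub, sub_mul, sub_mul, sub_mul, trace_sub, trace_sub, trace_sub,
        e1, e2, e3, e4]
      ring
    rw [h1, h, h, h]
    simp only [← Finset.sum_sub_distrib, ← Finset.sum_add_distrib]
    refine Finset.sum_congr rfl fun i _ => Finset.sum_congr rfl fun j _ => ?_
    ring
  have hr2 : ((A - C) * (A - C) * C ^ r).trace =
      ∑ i, ∑ j, w i j * ((a i - c j) ^ 2 * c j ^ r) := by
    have h1 : ((A - C) * (A - C) * C ^ r).trace =
        (A ^ 2 * C ^ r).trace - (A ^ 1 * C ^ (r + 1)).trace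
          - (A ^ 1 * C ^ (r + 1)).trace + (A ^ 0 * C ^ (r + 2)).trace := by
      have e1 : (A * C * C ^ r).trace = (A ^ 1 * C ^ (r + 1)).trace := by
        rw [Matrix.mul_assoc, ← pow_succ', pow_one]
      have e2 : (C * A * C ^ r).trace = (A ^ 1 * C ^ (r + 1)).trace := by
        rw [Matrix.mul_assoc, Matrix.trace_mul_comm, Matrix.mul_assoc, ← pow_succ, pow_one]
      have e3 : (C * C * C ^ r).trace = (A ^ 0 * C ^ (r + 2)).trace := by
        rw [pow_zero, Matrix.one_mul, ← sq, ← pow_add, add_comm]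
      rw [sub_mul, mul_sub, mul_sub, sub_mul, sub_mul, sub_mul, trace_sub, trace_sub, trace_sub,
        e1, e2, e3, ← sq]
      ring
    rw [h1, h, h, h]
    simp only [← Finset.sum_sub_distrib, ← Finset.sum_add_distrib]
    refine Finset.sum_congr rfl fun i _ => Finset.sum_congr rfl fun j _ => ?_
    ring
  rw [hl, hr1, hr2]
  simp only [← Finset.sum_add_distrib, Finset.mul_sum]
  refine Finset.sum_le_sum fun i _ => Finset.sum_le_sum fun j _ => ?_
  have := mul_le_mul_of_nonneg_left (two_mul_sub_mul_pow_sub_le hr (a i) (c j)) (hw i j)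
  linarith

theorem trace_transpose_mul_self_eq_sum {n : Type*} [Fintype n] (A : Matrix n n ℝ) :
    (Aᵀ * A).trace = ∑ j, (A.col j) ⬝ᵥ (A.col j) := by
  simp [Matrix.trace, Matrix.mul_apply, dotProduct]

/-- For even `r`, the factor `H * H` is controlled by the bound `b` of the square of the operator norm
of `H`, because the power `A ^ r` is positive semidefinite. -/
theorem trace_mul_self_mul_pow_le {r : ℕ} (hr : Even r) {A H : Matrix n n ℝ}
    (hA : A.IsHermitian) (hH : H.IsHermitian) {b : ℝ}
    (hb : ∀ x, (H *ᵥ x) ⬝ᵥ (H *ᵥ x) ≤ b * (x ⬝ᵥ x)) :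
    (H * H * A ^ r).trace ≤ b * (A ^ r).trace := by
  obtain ⟨s, rfl⟩ := hr
  have hAs : (A ^ s)ᵀ = A ^ s := (hA.pow s)
  have hHt : Hᵀ = H := hH
  have h1 : (H * H * A ^ (s + s)).trace = ((H * A ^ s)ᵀ * (H * A ^ s)).trace := by
    rw [transpose_mul, hAs, hHt, pow_add, ← Matrix.mul_assoc, Matrix.trace_mul_comm]
    simp only [Matrix.mul_assoc]
  have h2 : (A ^ (s + s)).trace = ((A ^ s)ᵀ * A ^ s).trace := by rw [hAs, pow_add]
  rw [h1, h2, trace_transpose_mul_self_eq_sum, trace_transpose_mul_self_eq_sum, Finset.mul_sum]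
  refine Finset.sum_le_sum fun j _ => ?_
  exact hb ((A ^ s).col j)

/-- The operator norm of a symmetric matrix is bounded by its Schatten norms of even order. -/
theorem dotProduct_mulVec_pow_le {A : Matrix n n ℝ} (hA : A.IsHermitian) (p : ℕ) (x : n → ℝ)
    (hx : x ⬝ᵥ x ≤ 1) : ((A *ᵥ x) ⬝ᵥ (A *ᵥ x)) ^ (p + 1) ≤ (A ^ (2 * (p + 1))).trace := by
  obtain ⟨U, a, hU1, hU2, hU⟩ := exists_pow_eq_of_isHermitian hA
  have hAt : Aᵀ = A := hA
  have hq : ∀ q : ℕ, x ⬝ᵥ (A ^ q *ᵥ x) = ∑ i, (Uᵀ *ᵥ x) i ^ 2 * a i ^ q := by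
    intro q
    rw [hU, ← mulVec_mulVec, ← mulVec_mulVec, dotProduct_mulVec, ← mulVec_transpose]
    simp only [dotProduct, mulVec_diagonal]
    refine Finset.sum_congr rfl fun i _ => ?_
    ring
  have h0 : ∑ i, (Uᵀ *ᵥ x) i ^ 2 ≤ 1 := by
    have := hq 0
    simp only [pow_zero, one_mulVec, mul_one] at this
    rwa [← this]
  have h2 : (A *ᵥ x) ⬝ᵥ (A *ᵥ x) = ∑ i, (Uᵀ *ᵥ x) i ^ 2 * a i ^ 2 := by
    rw [← hq, dotProduct_mulVec, ← mulVec_transpose, hAt, mulVec_mulVec, ← sq, dotProduct_comm]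
  have h3 : (A ^ (2 * (p + 1))).trace = ∑ i, (a i ^ 2) ^ (p + 1) := by
    rw [hU, Matrix.trace_mul_comm, ← Matrix.mul_assoc, hU1, Matrix.one_mul, trace_diagonal]
    simp only [pow_mul]
  rw [h2, h3]
  rcases isEmpty_or_nonempty n with hn | hn
  · simp
  obtain ⟨k, hk⟩ := Finite.exists_max fun i => a i ^ 2
  have h4 : ∑ i, (Uᵀ *ᵥ x) i ^ 2 * a i ^ 2 ≤ a k ^ 2 :=
    calc ∑ i, (Uᵀ *ᵥ x) i ^ 2 * a i ^ 2 ≤ ∑ i, (Uᵀ *ᵥ x) i ^ 2 * a k ^ 2 :=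
          Finset.sum_le_sum fun i _ => mul_le_mul_of_nonneg_left (hk i) (sq_nonneg _)
      _ ≤ 1 * a k ^ 2 := by
          rw [← Finset.sum_mul]
          exact mul_le_mul_of_nonneg_right h0 (sq_nonneg _)
      _ = a k ^ 2 := one_mul _
  calc (∑ i, (Uᵀ *ᵥ x) i ^ 2 * a i ^ 2) ^ (p + 1) ≤ (a k ^ 2) ^ (p + 1) :=
        pow_le_pow_left₀ (Finset.sum_nonneg fun i _ => by positivity) h4 _
    _ ≤ ∑ i, (a i ^ 2) ^ (p + 1) :=
        Finset.single_le_sum (f := fun i => (a i ^ 2) ^ (p + 1)) (fun i _ => by positivity)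
          (Finset.mem_univ k)

/-! ### Moments of matrix Rademacher sums -/

section Rademacher

variable {ι : Type*} [Fintype ι] [DecidableEq ι]

/-- The signed sum `∑ l, ε l • x l` with signs `ε l = ±1`. -/
def signedSum {E : Type*} [AddCommGroup E] [Module ℝ E] (x : ι → E) (ε : ι → ℤˣ) : E :=
  ∑ l, ((ε l : ℤ) : ℝ) • x l

/-- The involution of the set of signs that changes the sign number `l`. -/
def flipSign (l : ι) : (ι → ℤˣ) ≃ (ι → ℤˣ) := Equiv.mulLeft (Pi.mulSingle l (-1))

theorem signedSum_sub_flipSign {E : Type*} [AddCommGroup E] [Module ℝ E] (x : ι → E)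
    (ε : ι → ℤˣ) (l : ι) :
    signedSum x ε - signedSum x (flipSign l ε) = (2 * ((ε l : ℤ) : ℝ)) • x l := by
  unfold signedSum
  rw [← Finset.sum_sub_distrib, Finset.sum_eq_single l]
  · simp [flipSign, two_mul, add_smul]
  · intro k _ hk
    simp [flipSign, Pi.mulSingle_eq_of_ne hk]
  · simp

theorem sign_mul_self (e : ℤˣ) : ((e : ℤ) : ℝ) * ((e : ℤ) : ℝ) = 1 := by
  rcases Int.units_eq_one_or e with rfl | rfl <;> simp

theorem isHermitian_signedSum {n ι : Type*} [Fintype ι] {H : ι → Matrix n n ℝ} (hH : ∀ l, (H l).IsHermitian)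
    (ε : ι → ℤˣ) : (signedSum H ε).IsHermitian := by
  unfold signedSum
  rw [Matrix.IsHermitian, conjTranspose_sum]
  refine Finset.sum_congr rfl fun l _ => ?_
  rw [conjTranspose_smul, (hH l).eq, star_trivial]

/-- In `∑ ε, tr (S ε ^ (r + 2))` one factor `S ε` is expanded into its summands `ε l • H l`; averaging
the summand number `l` with its value after the change of the sign number `l` leaves a difference of
two powers, whose arguments differ by `2 ε l • H l`. -/
theorem four_mul_sum_trace_pow_succ (H : ι → Matrix n n ℝ) (r : ℕ) :
    4 * ∑ ε, (signedSum H ε ^ (r + 2)).trace =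
      ∑ l, ∑ ε, ((signedSum H ε - signedSum H (flipSign l ε)) *
        (signedSum H ε ^ (r + 1) - signedSum H (flipSign l ε) ^ (r + 1))).trace := by
  have h1 : ∀ ε : ι → ℤˣ, (signedSum H ε ^ (r + 2)).trace =
      ∑ l, ((ε l : ℤ) : ℝ) * (H l * signedSum H ε ^ (r + 1)).trace := by
    intro ε
    rw [pow_succ' _ (r + 1)]
    nth_rewrite 1 [signedSum]
    rw [Finset.sum_mul, trace_sum]
    refine Finset.sum_congr rfl fun l _ => ?_
    rw [smul_mul_assoc, trace_smul, smul_eq_mul]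
  simp_rw [h1]
  rw [Finset.sum_comm, Finset.mul_sum]
  refine Finset.sum_congr rfl fun l _ => ?_
  have h2 : ∑ ε : ι → ℤˣ, ((ε l : ℤ) : ℝ) * (H l * signedSum H ε ^ (r + 1)).trace =
      -∑ ε : ι → ℤˣ, ((ε l : ℤ) : ℝ) * (H l * signedSum H (flipSign l ε) ^ (r + 1)).trace := by
    rw [← Equiv.sum_comp (flipSign l), ← Finset.sum_neg_distrib]
    refine Finset.sum_congr rfl fun ε _ => ?_
    simp [flipSign]
  have h3 : ∀ ε : ι → ℤˣ, ((signedSum H ε - signedSum H (flipSign l ε)) *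
        (signedSum H ε ^ (r + 1) - signedSum H (flipSign l ε) ^ (r + 1))).trace =
      2 * (((ε l : ℤ) : ℝ) * (H l * signedSum H ε ^ (r + 1)).trace) -
      2 * (((ε l : ℤ) : ℝ) * (H l * signedSum H (flipSign l ε) ^ (r + 1)).trace) := by
    intro ε
    rw [signedSum_sub_flipSign, smul_mul_assoc, trace_smul, mul_sub, trace_sub, smul_eq_mul]
    ring
  simp_rw [h3]
  rw [Finset.sum_sub_distrib, ← Finset.mul_sum, ← Finset.mul_sum]
  linarith

theorem sum_trace_signedSum_sq (H : ι → Matrix n n ℝ) :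
    ∑ ε, (signedSum H ε ^ 2).trace = ∑ _ε : ι → ℤˣ, ∑ l, (H l * H l).trace := by
  have h := four_mul_sum_trace_pow_succ H 0
  simp only [zero_add, pow_one, signedSum_sub_flipSign] at h
  have h1 : ∀ (l : ι) (ε : ι → ℤˣ), ((2 * ((ε l : ℤ) : ℝ)) • H l *
      (2 * ((ε l : ℤ) : ℝ)) • H l).trace = 4 * (H l * H l).trace := by
    intro l ε
    rw [smul_mul_smul_comm, trace_smul, smul_eq_mul, mul_mul_mul_comm, sign_mul_self]
    ring
  simp_rw [h1] at h
  rw [Finset.sum_comm]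
  simp_rw [← Finset.mul_sum] at h
  linarith

/-- The recursion behind the noncommutative Khintchine inequality: raising the order of the moment by
two costs a factor `r + 1` and the sum of the bounds `b l` of the squared operator norms. -/
theorem sum_trace_signedSum_pow_add_two_le {H : ι → Matrix n n ℝ}
    (hH : ∀ l, (H l).IsHermitian) {b : ι → ℝ}
    (hb : ∀ l x, (H l *ᵥ x) ⬝ᵥ (H l *ᵥ x) ≤ b l * (x ⬝ᵥ x)) {r : ℕ} (hr : Even r) :
    ∑ ε, (signedSum H ε ^ (r + 2)).trace ≤
      (r + 1) * (∑ l, b l) * ∑ ε, (signedSum H ε ^ r).trace := by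
  have h := four_mul_sum_trace_pow_succ H r
  have h1 : ∀ (l : ι) (ε : ι → ℤˣ), ((signedSum H ε - signedSum H (flipSign l ε)) *
        (signedSum H ε ^ (r + 1) - signedSum H (flipSign l ε) ^ (r + 1))).trace ≤
      2 * (r + 1) * b l * ((signedSum H ε ^ r).trace + (signedSum H (flipSign l ε) ^ r).trace) := by
    intro l ε
    have h2 := two_mul_trace_sub_mul_pow_sub_le hr (isHermitian_signedSum hH ε)
      (isHermitian_signedSum hH (flipSign l ε))
    have h3 : (signedSum H ε - signedSum H (flipSign l ε)) *
        (signedSum H ε - signedSum H (flipSign l ε)) = (4 : ℝ) • (H l * H l) := by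
      rw [signedSum_sub_flipSign, smul_mul_smul_comm, mul_mul_mul_comm, sign_mul_self]
      norm_num
    rw [h3, smul_mul_assoc, smul_mul_assoc, trace_smul, trace_smul, smul_eq_mul,
      smul_eq_mul] at h2
    have h4 := trace_mul_self_mul_pow_le hr (isHermitian_signedSum hH ε) (hH l) (hb l)
    have h5 := trace_mul_self_mul_pow_le hr (isHermitian_signedSum hH (flipSign l ε)) (hH l) (hb l)
    have h6 := mul_le_mul_of_nonneg_left (add_le_add h4 h5) (by positivity : (0 : ℝ) ≤ r + 1)
    linarith
  have h2 : ∀ l, ∑ ε : ι → ℤˣ, ((signedSum H ε - signedSum H (flipSign l ε)) *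
        (signedSum H ε ^ (r + 1) - signedSum H (flipSign l ε) ^ (r + 1))).trace ≤
      4 * (r + 1) * b l * ∑ ε, (signedSum H ε ^ r).trace := by
    intro l
    refine (Finset.sum_le_sum fun ε _ => h1 l ε).trans_eq ?_
    rw [← Finset.mul_sum, Finset.sum_add_distrib,
      Equiv.sum_comp (flipSign l) fun ε => (signedSum H ε ^ r).trace]
    ring
  have h3 := Finset.sum_le_sum fun l (_ : l ∈ Finset.univ) => h2 l
  rw [← h, ← Finset.sum_mul, ← Finset.mul_sum] at h3
  linarith

/-- The noncommutative Khintchine inequality for even moments. -/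
theorem sum_trace_signedSum_pow_le {H : ι → Matrix n n ℝ}
    (hH : ∀ l, (H l).IsHermitian) {b : ι → ℝ} (hb0 : ∀ l, 0 ≤ b l)
    (hb : ∀ l x, (H l *ᵥ x) ⬝ᵥ (H l *ᵥ x) ≤ b l * (x ⬝ᵥ x)) (p : ℕ) :
    ∑ ε, (signedSum H ε ^ (2 * (p + 1))).trace ≤
      (2 * p + 1).doubleFactorial * (∑ l, b l) ^ p *
        ∑ _ε : ι → ℤˣ, ∑ l, (H l * H l).trace := by
  induction p with
  | zero => simp [sum_trace_signedSum_sq]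
  | succ p ih =>
    have h := sum_trace_signedSum_pow_add_two_le hH hb (even_two_mul (p + 1))
    have hv : 0 ≤ ∑ l, b l := Finset.sum_nonneg fun l _ => hb0 l
    rw [show 2 * (p + 1 + 1) = 2 * (p + 1) + 2 by ring]
    refine h.trans ((mul_le_mul_of_nonneg_left ih (by positivity)).trans_eq ?_)
    rw [show 2 * (p + 1) + 1 = 2 * p + 1 + 2 by ring, Nat.doubleFactorial_add_two]
    push_cast
    ring

end Rademacher

/-- The noncommutative Khintchine inequality for matrices that need not be symmetric, by passing to
the symmetric matrices with off-diagonal blocks `B l` and `(B l)ᵀ`. -/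
theorem sum_dotProduct_signedSum_pow_le {ι : Type*} [Fintype ι] [DecidableEq ι]
    {B : ι → Matrix n n ℝ} {b : ι → ℝ} (hb0 : ∀ l, 0 ≤ b l)
    (hb : ∀ l x, (B l *ᵥ x) ⬝ᵥ (B l *ᵥ x) ≤ b l * (x ⬝ᵥ x))
    (hb' : ∀ l x, ((B l)ᵀ *ᵥ x) ⬝ᵥ ((B l)ᵀ *ᵥ x) ≤ b l * (x ⬝ᵥ x)) (p : ℕ)
    (x : (ι → ℤˣ) → n → ℝ) (hx : ∀ ε, x ε ⬝ᵥ x ε ≤ 1) :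
    ∑ ε, ((signedSum B ε *ᵥ x ε) ⬝ᵥ (signedSum B ε *ᵥ x ε)) ^ (p + 1) ≤
      (2 * p + 1).doubleFactorial * (∑ l, b l) ^ p *
        ∑ _ε : ι → ℤˣ, ∑ l, 2 * ((B l)ᵀ * B l).trace := by
  let H : ι → Matrix (n ⊕ n) (n ⊕ n) ℝ := fun l => fromBlocks 0 (B l) (B l)ᵀ 0
  have hH : ∀ l, (H l).IsHermitian := fun l =>
    IsHermitian.fromBlocks (by simp [IsHermitian]) (by simp) (by simp [IsHermitian])
  have hS : ∀ ε, signedSum H ε = fromBlocks 0 (signedSum B ε) (signedSum B ε)ᵀ 0 := by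
    intro ε
    ext i j
    rcases i with i | i <;> rcases j with j | j <;> simp [H, signedSum, Matrix.sum_apply]
  have hbH : ∀ l y, (H l *ᵥ y) ⬝ᵥ (H l *ᵥ y) ≤ b l * (y ⬝ᵥ y) := by
    intro l y
    obtain ⟨y1, y2, rfl⟩ : ∃ y1 y2, y = Sum.elim y1 y2 :=
      ⟨y ∘ Sum.inl, y ∘ Sum.inr, (Sum.elim_comp_inl_inr y).symm⟩
    have h1 := hb l y2
    have h2 := hb' l y1
    simp only [H, fromBlocks_mulVec, sumElim_dotProduct_sumElim, Sum.elim_comp_inl,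
      Sum.elim_comp_inr, zero_mulVec, zero_add, add_zero]
    linarith
  have hx' : ∀ ε, (Sum.elim 0 (x ε) : n ⊕ n → ℝ) ⬝ᵥ Sum.elim 0 (x ε) ≤ 1 := by
    intro ε
    simpa [sumElim_dotProduct_sumElim] using hx ε
  have htr : ∀ l, (H l * H l).trace = 2 * ((B l)ᵀ * B l).trace := by
    intro l
    have h1 := Matrix.trace_mul_comm (B l) (B l)ᵀ
    simp only [H, fromBlocks_multiply, Matrix.zero_mul, Matrix.mul_zero, zero_add, add_zero]
    simp only [Matrix.trace, diag_apply, Fintype.sum_sum_type, fromBlocks_apply₁₁,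
      fromBlocks_apply₂₂] at h1 ⊢
    linarith
  have h := sum_trace_signedSum_pow_le hH hb0 hbH p
  simp_rw [htr] at h
  refine le_trans (Finset.sum_le_sum fun ε _ => ?_) h
  have h1 := dotProduct_mulVec_pow_le (isHermitian_signedSum hH ε) p _ (hx' ε)
  refine le_trans (le_of_eq ?_) h1
  rw [hS]
  simp [fromBlocks_mulVec, sumElim_dotProduct_sumElim]

end Matrices

/-! ### Rademacher sums of Hilbert-Schmidt operators -/

section Hilbert

variable {H : Type*} [NormedAddCommGroup H] [InnerProductSpace ℝ H] [CompleteSpace H]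

theorem ofReal_sum_norm_sq_le_posTrace {κ : Type*} [Fintype κ] {e : κ → H}
    (he : Orthonormal ℝ e) (T : H →L[ℝ] H) :
    ENNReal.ofReal (∑ i, ‖T (e i)‖ ^ 2) ≤ posTrace (ContinuousLinearMap.adjoint T ∘L T) := by
  obtain ⟨w, b, hw, hb⟩ := he.toSubtypeRange.exists_hilbertBasis_extension
  rw [posTrace_adjoint_comp_self b, ENNReal.ofReal_sum_of_nonneg fun i _ => sq_nonneg _,
    ← tsum_fintype (L := SummationFilter.unconditional _)]
  let g : κ → w := fun i => ⟨e i, hw (mem_range_self i)⟩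
  have hg : Function.Injective g := fun i j hij =>
    he.linearIndependent.injective (congrArg Subtype.val hij)
  have h := ENNReal.tsum_comp_le_tsum_of_injective hg
    fun i => ENNReal.ofReal (‖T (b i)‖ ^ 2)
  refine le_trans (le_of_eq ?_) h
  simp only [hb, g]

theorem ofReal_norm_sq_le_posTrace (T : H →L[ℝ] H) :
    ENNReal.ofReal (‖T‖ ^ 2) ≤ posTrace (ContinuousLinearMap.adjoint T ∘L T) := by
  by_cases htop : posTrace (ContinuousLinearMap.adjoint T ∘L T) = ∞
  · rw [htop]; exact le_top
  rw [ENNReal.ofReal_le_iff_le_toReal htop]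
  refine (Real.le_sqrt (norm_nonneg _) ENNReal.toReal_nonneg).1 ?_
  refine ContinuousLinearMap.opNorm_le_of_unit_norm (Real.sqrt_nonneg _) fun x hx => ?_
  refine Real.le_sqrt_of_sq_le ?_
  have he : Orthonormal ℝ fun _ : Unit => x :=
    ⟨fun _ => hx, fun i j hij => (hij (Subsingleton.elim i j)).elim⟩
  simpa using (ENNReal.ofReal_le_iff_le_toReal htop).1 (ofReal_sum_norm_sq_le_posTrace he T)

end Hilbert

section Compression

variable {H : Type*} [NormedAddCommGroup H] [InnerProductSpace ℝ H]
variable {κ : Type*} {e : κ → H}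

/-- The matrix of the compression of an operator to the span of an orthonormal family. -/
def compression (e : κ → H) (T : H →L[ℝ] H) : Matrix κ κ ℝ :=
  Matrix.of fun i j => inner ℝ (e i) (T (e j))

theorem compression_transpose [CompleteSpace H] (T : H →L[ℝ] H) :
    (compression e T)ᵀ = compression e (ContinuousLinearMap.adjoint T) := by
  ext i j
  rw [transpose_apply, compression, compression, of_apply, of_apply,
    ContinuousLinearMap.adjoint_inner_right, real_inner_comm]

theorem compression_signedSum {ι : Type*} [Fintype ι] (B : ι → H →L[ℝ] H) (ε : ι → ℤˣ) :
    compression e (signedSum B ε) = signedSum (fun l => compression e (B l)) ε := by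
  ext i j
  simp [signedSum, compression, Matrix.sum_apply, inner_sum,
    inner_smul_right]

variable [Fintype κ]

theorem compression_mulVec (T : H →L[ℝ] H) (c : κ → ℝ) (i : κ) :
    (compression e T *ᵥ c) i = inner ℝ (e i) (T (∑ j, c j • e j)) := by
  simp only [mulVec, dotProduct, compression, of_apply, map_sum, inner_sum, map_smul,
    inner_smul_right]
  exact Finset.sum_congr rfl fun j _ => mul_comm _ _

theorem dotProduct_inner_le (he : Orthonormal ℝ e) (z : H) :
    (fun i => inner ℝ (e i) z) ⬝ᵥ (fun i => inner ℝ (e i) z) ≤ ‖z‖ ^ 2 := by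
  have h := he.sum_inner_products_le z (s := Finset.univ)
  simpa [dotProduct, ← sq] using h

theorem norm_sum_smul_sq (he : Orthonormal ℝ e) (c : κ → ℝ) :
    ‖∑ j, c j • e j‖ ^ 2 = c ⬝ᵥ c := by
  rw [← real_inner_self_eq_norm_sq, he.inner_sum]
  simp [dotProduct]

theorem compression_bound (he : Orthonormal ℝ e) (T : H →L[ℝ] H) (c : κ → ℝ) :
    (compression e T *ᵥ c) ⬝ᵥ (compression e T *ᵥ c) ≤ ‖T‖ ^ 2 * (c ⬝ᵥ c) := by
  rw [funext (compression_mulVec T c), ← norm_sum_smul_sq he c, ← mul_pow]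
  exact (dotProduct_inner_le he _).trans (pow_le_pow_left₀ (norm_nonneg _) (T.le_opNorm _) 2)

theorem trace_compression_le [CompleteSpace H] (he : Orthonormal ℝ e) (T : H →L[ℝ] H)
    (hT : posTrace (ContinuousLinearMap.adjoint T ∘L T) ≠ ∞) :
    ((compression e T)ᵀ * compression e T).trace ≤
      (posTrace (ContinuousLinearMap.adjoint T ∘L T)).toReal := by
  have h1 := (ENNReal.ofReal_le_iff_le_toReal hT).1 (ofReal_sum_norm_sq_le_posTrace he T)
  rw [trace_transpose_mul_self_eq_sum]
  exact (Finset.sum_le_sum fun j _ => dotProduct_inner_le he (T (e j))).trans h1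

end Compression

section Moments

variable {H : Type*} [NormedAddCommGroup H] [InnerProductSpace ℝ H] [CompleteSpace H]
variable {ι : Type*} [Fintype ι] [DecidableEq ι] {B : ι → H →L[ℝ] H}

/-- The Khintchine inequality for the norms of finitely many vectors. Only the finite-dimensional span
of the vectors `x ε` and of their images matters, and compression to it increases neither the
operator norms nor the Hilbert-Schmidt norms. -/
theorem sum_norm_signedSum_apply_pow_le
    (hB : ∀ l, posTrace (ContinuousLinearMap.adjoint (B l) ∘L B l) ≠ ∞) (p : ℕ)
    (x : (ι → ℤˣ) → H) (hx : ∀ ε, ‖x ε‖ ≤ 1) :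
    ∑ ε, ‖signedSum B ε (x ε)‖ ^ (2 * (p + 1)) ≤
      (2 * p + 1).doubleFactorial * (∑ l, ‖B l‖ ^ 2) ^ p * ∑ _ε : ι → ℤˣ, ∑ l,
        2 * (posTrace (ContinuousLinearMap.adjoint (B l) ∘L B l)).toReal := by
  let V : Submodule ℝ H :=
    Submodule.span ℝ (range x ∪ range fun ε => signedSum B ε (x ε))
  have : FiniteDimensional ℝ V :=
    FiniteDimensional.span_of_finite ℝ ((finite_range _).union (finite_range _))
  let b := stdOrthonormalBasis ℝ V
  let e : Fin (Module.finrank ℝ V) → H := fun i => b i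
  have he : Orthonormal ℝ e := b.orthonormal.comp_linearIsometry V.subtypeₗᵢ
  have hVe : ∀ z ∈ V, ∑ i, (inner ℝ (e i) z : ℝ) • e i = z := by
    intro z hz
    have h := b.sum_repr' ⟨z, hz⟩
    have h' := congrArg (Subtype.val) h
    simpa [e] using h'
  have hVn : ∀ z ∈ V, (fun i => inner ℝ (e i) z : _ → ℝ) ⬝ᵥ (fun i => inner ℝ (e i) z) =
      ‖z‖ ^ 2 := by
    intro z hz
    rw [← norm_sum_smul_sq he, hVe z hz]
  have hxV : ∀ ε, x ε ∈ V := fun ε => Submodule.subset_span (Or.inl (mem_range_self ε))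
  have hSV : ∀ ε, signedSum B ε (x ε) ∈ V := fun ε =>
    Submodule.subset_span (Or.inr ⟨ε, rfl⟩)
  have h := sum_dotProduct_signedSum_pow_le (B := fun l => compression e (B l))
    (b := fun l => ‖B l‖ ^ 2) (fun l => sq_nonneg _) (fun l c => compression_bound he (B l) c)
    (fun l c => by
      rw [compression_transpose, ← LinearIsometryEquiv.norm_map ContinuousLinearMap.adjoint (B l)]
      exact compression_bound he _ c) p
    (fun ε i => inner ℝ (e i) (x ε)) (fun ε => by
      rw [hVn _ (hxV ε)]
      exact pow_le_one₀ (norm_nonneg _) (hx ε))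
  refine (le_of_eq (Finset.sum_congr rfl fun ε _ => ?_)).trans (h.trans ?_)
  · rw [← compression_signedSum, funext (compression_mulVec _ _), hVe _ (hxV ε), hVn _ (hSV ε),
      pow_mul]
  · refine mul_le_mul_of_nonneg_left ?_ (by positivity)
    exact Finset.sum_le_sum fun ε _ => Finset.sum_le_sum fun l _ =>
      mul_le_mul_of_nonneg_left (trace_compression_le he (B l) (hB l)) zero_le_two

theorem sum_norm_signedSum_pow_le
    (hB : ∀ l, posTrace (ContinuousLinearMap.adjoint (B l) ∘L B l) ≠ ∞) (p : ℕ) :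
    ∑ ε, ‖signedSum B ε‖ ^ (2 * (p + 1)) ≤
      (2 * p + 1).doubleFactorial * (∑ l, ‖B l‖ ^ 2) ^ p * ∑ _ε : ι → ℤˣ, ∑ l,
        2 * (posTrace (ContinuousLinearMap.adjoint (B l) ∘L B l)).toReal := by
  have hcont : Continuous fun η : ℝ =>
      ∑ ε, (max 0 (‖signedSum B ε‖ - η)) ^ (2 * (p + 1)) := by fun_prop
  have hlim := (hcont.tendsto 0).mono_left (nhdsWithin_le_nhds (s := Ioi 0))
  have h0 : ∀ ε, max 0 (‖signedSum B ε‖ - 0) = ‖signedSum B ε‖ := fun ε => by simp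
  simp only [h0] at hlim
  refine le_of_tendsto hlim ?_
  filter_upwards [self_mem_nhdsWithin] with η hη
  have hη' : (0 : ℝ) < η := hη
  have hx : ∀ ε, ∃ x : H, ‖x‖ < 1 ∧ ‖signedSum B ε‖ - η < ‖signedSum B ε x‖ := fun ε =>
    (signedSum B ε).exists_lt_apply_of_lt_opNorm (by linarith)
  choose x hx1 hx2 using hx
  refine le_trans (Finset.sum_le_sum fun ε _ => ?_)
    (sum_norm_signedSum_apply_pow_le hB p x fun ε => (hx1 ε).le)
  exact pow_le_pow_left₀ (le_max_left _ _) (max_le (norm_nonneg _) (hx2 ε).le) _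

end Moments

/-- A Stirling bound for the moments of a Gaussian variable. In this form the induction step is the
inequality `log (1 + x) ≥ 2 x / (x + 2)`. -/
theorem doubleFactorial_le_pow (p : ℕ) :
    ((2 * p + 1).doubleFactorial : ℝ) ≤ ((2 * p + 3) / Real.exp 1) ^ (p + 1) := by
  have he := Real.exp_pos 1
  induction p with
  | zero =>
    have : Real.exp 1 < 3 := Real.exp_one_lt_three
    rw [zero_add, pow_one, le_div_iff₀ he]
    norm_num
    linarith
  | succ p ih =>
    have hx : (0 : ℝ) ≤ 2 / (2 * p + 3) := by positivity
    have h1 := Real.le_log_one_add_of_nonneg hx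
    have h2 : 2 * (2 / (2 * (p : ℝ) + 3)) / (2 / (2 * p + 3) + 2) = 1 / (p + 2) := by
      field_simp; ring
    have h3 : (1 : ℝ) + 2 / (2 * p + 3) = (2 * p + 5) / (2 * p + 3) := by
      field_simp; ring
    rw [h2, h3] at h1
    have h4 : Real.exp 1 ≤ ((2 * (p : ℝ) + 5) / (2 * p + 3)) ^ (p + 2) := by
      have h5 : (0 : ℝ) < (2 * p + 5) / (2 * p + 3) := by positivity
      rw [← Real.exp_log (pow_pos h5 _), Real.log_pow]
      refine Real.exp_le_exp.2 ?_
      push_cast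
      rw [div_le_iff₀ (by positivity)] at h1
      linarith
    rw [show 2 * (p + 1) + 1 = 2 * p + 1 + 2 by ring, Nat.doubleFactorial_add_two]
    push_cast
    calc (2 * (p : ℝ) + 1 + 2) * ((2 * p + 1).doubleFactorial : ℝ)
        ≤ (2 * p + 1 + 2) * ((2 * p + 3) / Real.exp 1) ^ (p + 1) := by gcongr
      _ = Real.exp 1 * ((2 * p + 3) / Real.exp 1) ^ (p + 2) := by
          rw [pow_succ _ (p + 1)]; field_simp; ring
      _ ≤ ((2 * (p : ℝ) + 5) / (2 * p + 3)) ^ (p + 2) * ((2 * p + 3) / Real.exp 1) ^ (p + 2) := by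
          gcongr
      _ = _ := by
          rw [← mul_pow]
          congr 1
          field_simp
          ring

/-- The choice of the order of the moment: about `log (t / v)`, which turns the factor `t / v` into a
constant. -/
theorem le_of_forall_pow_le {y v t : ℝ} (hv : 0 < v) (hvt : v ≤ t)
    (h : ∀ p : ℕ, y ^ (p + 1) ≤ (2 * p + 1).doubleFactorial * v ^ p * (2 * t)) :
    y ≤ 2 * ((Real.log (t / v) + 2.7) * v) := by
  have ht : 0 < t := hv.trans_le hvt
  have hX : 0 ≤ Real.log (t / v) := Real.log_nonneg ((one_le_div hv).2 hvt)
  have hl2 := Real.log_pos one_lt_two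
  have hl2' := Real.log_two_lt_d9
  -- With `p + 1 ≥ log (t / v) + log 2`, the factor `2 t / v` is at most `exp (p + 1)`, which cancels
  -- against the Stirling bound.
  obtain ⟨p, hp⟩ : ∃ p : ℕ, p + 1 = ⌈Real.log (t / v) + Real.log 2⌉₊ :=
    ⟨⌈Real.log (t / v) + Real.log 2⌉₊ - 1,
      Nat.sub_add_cancel (Nat.one_le_ceil_iff.2 (by linarith))⟩
  have hp1 := Nat.le_ceil (Real.log (t / v) + Real.log 2)
  have hp2 := Nat.ceil_lt_add_one (a := Real.log (t / v) + Real.log 2) (by linarith)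
  rw [← hp] at hp1 hp2
  push_cast at hp1 hp2
  have he := Real.exp_pos 1
  have h1 : 2 * t ≤ Real.exp 1 ^ (p + 1) * v := by
    have h2 : Real.exp (Real.log (t / v) + Real.log 2) ≤ Real.exp (p + 1) := Real.exp_le_exp.2 hp1
    rw [Real.exp_add, Real.exp_log (by positivity), Real.exp_log two_pos] at h2
    rw [← Real.exp_nat_mul]
    push_cast
    rw [mul_one]
    calc 2 * t = t / v * 2 * v := by field_simp
      _ ≤ _ := by gcongr
  have h3 : y ^ (p + 1) ≤ ((2 * p + 3) * v) ^ (p + 1) :=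
    calc y ^ (p + 1) ≤ (2 * p + 1).doubleFactorial * v ^ p * (2 * t) := h p
      _ ≤ ((2 * p + 3) / Real.exp 1) ^ (p + 1) * v ^ p * (Real.exp 1 ^ (p + 1) * v) := by
          gcongr
          exact doubleFactorial_le_pow p
      _ = _ := by
          rw [div_pow, mul_pow, pow_succ v]
          field_simp
  have h4 : y ≤ (2 * p + 3) * v := le_of_pow_le_pow_left₀ (Nat.succ_ne_zero p) (by positivity) h3
  refine h4.trans ?_
  rw [← mul_assoc]
  refine mul_le_mul_of_nonneg_right ?_ hv.le
  norm_num at hl2' ⊢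
  linarith

section Hilbert

variable {H : Type*} [NormedAddCommGroup H] [InnerProductSpace ℝ H] [CompleteSpace H]

/-- The mean square of the norm of a Rademacher sum of Hilbert-Schmidt operators, with an intrinsic
dimension in the logarithm. -/
theorem sum_norm_signedSum_sq_le {ι : Type*} [Fintype ι] [DecidableEq ι] {B : ι → H →L[ℝ] H}
    (hB : ∀ l, posTrace (ContinuousLinearMap.adjoint (B l) ∘L B l) ≠ ∞) :
    ∑ ε, ‖signedSum B ε‖ ^ 2 ≤ Fintype.card (ι → ℤˣ) * (2 * ((Real.log
      ((∑ l, (posTrace (ContinuousLinearMap.adjoint (B l) ∘L B l)).toReal) / ∑ l, ‖B l‖ ^ 2) + 2.7)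
        * ∑ l, ‖B l‖ ^ 2)) := by
  set v := ∑ l, ‖B l‖ ^ 2 with hv
  set t := ∑ l, (posTrace (ContinuousLinearMap.adjoint (B l) ∘L B l)).toReal with ht
  have hN : (0 : ℝ) < Fintype.card (ι → ℤˣ) := by exact_mod_cast Fintype.card_pos
  have hvt : v ≤ t := Finset.sum_le_sum fun l _ =>
    (ENNReal.ofReal_le_iff_le_toReal (hB l)).1 (ofReal_norm_sq_le_posTrace (B l))
  rcases (show 0 ≤ v from Finset.sum_nonneg fun l _ => sq_nonneg ‖B l‖).eq_or_lt with h0 | hpos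
  · have hz : ∀ l, B l = 0 := fun l => by
      have := (Finset.sum_eq_zero_iff_of_nonneg fun l _ => sq_nonneg ‖B l‖).1 h0.symm l
        (Finset.mem_univ l)
      simpa using this
    rw [← h0]
    simp [signedSum, hz]
  rw [← div_le_iff₀' hN]
  refine le_of_forall_pow_le hpos hvt fun p => ?_
  have h := sum_norm_signedSum_pow_le hB p
  have h2 := Real.pow_arith_mean_le_arith_mean_pow Finset.univ
    (fun _ : ι → ℤˣ => (Fintype.card (ι → ℤˣ) : ℝ)⁻¹) (fun ε => ‖signedSum B ε‖ ^ 2)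
    (fun _ _ => by positivity) (by simp) (fun _ _ => by positivity) (p + 1)
  rw [← Finset.mul_sum, ← Finset.mul_sum, ← div_eq_inv_mul, ← div_eq_inv_mul] at h2
  refine h2.trans ?_
  rw [div_le_iff₀ hN]
  simp only [← pow_mul]
  refine h.trans_eq ?_
  rw [Finset.sum_const, ← Finset.mul_sum, ← ht, ← hv, nsmul_eq_mul, Finset.card_univ]
  ring

end Hilbert

end RandomOrdinate

namespace RandomOrdinate

/-! ### Symmetrization of independent sums -/

section Symmetrization

variable {Ω : Type*} [MeasurableSpace Ω] {P : Measure Ω} [IsProbabilityMeasure P]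
variable {E : Type*} [NormedAddCommGroup E] [NormedSpace ℝ E]

theorem sq_integral_le_integral_sq {f : Ω → ℝ} (hf : Integrable f P)
    (hf2 : Integrable (fun ω => f ω ^ 2) P) : (∫ ω, f ω ∂P) ^ 2 ≤ ∫ ω, f ω ^ 2 ∂P :=
  (even_two.convexOn_pow).map_integral_le (continuous_pow 2).continuousOn isClosed_univ
    (Filter.Eventually.of_forall fun _ => mem_univ _) hf hf2

/-- Adding an independent centered random vector does not decrease the mean square norm. -/
theorem integral_norm_sq_le_of_indepFun [CompleteSpace E] {α β : Type*} [MeasurableSpace α]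
    [MeasurableSpace β]
    {A : Ω → α} {B : Ω → β} (hA : Measurable A) (hB : Measurable B) (hAB : IndepFun A B P)
    {g : α → E} {h : β → E} (hg : StronglyMeasurable g) (hh : StronglyMeasurable h) {K L : ℝ}
    (hgK : ∀ a, ‖g a‖ ≤ K) (hhL : ∀ b, ‖h b‖ ≤ L) (h0 : ∫ ω, h (B ω) ∂P = 0) :
    ∫ ω, ‖g (A ω)‖ ^ 2 ∂P ≤ ∫ ω, ‖g (A ω) - h (B ω)‖ ^ 2 ∂P := by
  have := Measure.isProbabilityMeasure_map (μ := P) hA.aemeasurable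
  have := Measure.isProbabilityMeasure_map (μ := P) hB.aemeasurable
  have hF : StronglyMeasurable fun p : α × β => ‖g p.1 - h p.2‖ ^ 2 :=
    ((hg.comp_measurable measurable_fst).sub (hh.comp_measurable measurable_snd)).norm.pow 2
  have hb : ∀ a b, ‖g a - h b‖ ≤ K + L := fun a b =>
    (norm_sub_le _ _).trans (add_le_add (hgK a) (hhL b))
  have hb2 : ∀ a b, ‖‖g a - h b‖ ^ 2‖ ≤ (K + L) ^ 2 := fun a b => by
    rw [norm_pow, norm_norm]
    exact pow_le_pow_left₀ (norm_nonneg _) (hb a b) 2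
  have h1 : ∫ ω, ‖g (A ω) - h (B ω)‖ ^ 2 ∂P =
      ∫ a, ∫ b, ‖g a - h b‖ ^ 2 ∂(P.map B) ∂(P.map A) := by
    rw [← integral_prod (fun p : α × β => ‖g p.1 - h p.2‖ ^ 2)
      (Integrable.of_bound hF.aestronglyMeasurable _ (Filter.Eventually.of_forall fun p => hb2 _ _)),
      ← (indepFun_iff_map_prod_eq_prod_map_map hA.aemeasurable hB.aemeasurable).1 hAB,
      integral_map (hA.prodMk hB).aemeasurable hF.aestronglyMeasurable]
  rw [h1, ← integral_map (φ := A) (f := fun a => ‖g a‖ ^ 2) hA.aemeasurable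
    (hg.norm.pow 2).aestronglyMeasurable]
  refine integral_mono (Integrable.of_bound (hg.norm.pow 2).aestronglyMeasurable (K ^ 2)
    (Filter.Eventually.of_forall fun a => ?_)) ?_ fun a => ?_
  · rw [norm_pow, norm_norm]
    exact pow_le_pow_left₀ (norm_nonneg _) (hgK a) 2
  · exact (Integrable.of_bound hF.aestronglyMeasurable _
      (Filter.Eventually.of_forall fun p => hb2 _ _)).integral_prod_left
  · have hs : StronglyMeasurable fun b => g a - h b := stronglyMeasurable_const.sub hh
    have hi : Integrable (fun b => g a - h b) (P.map B) :=
      Integrable.of_bound hs.aestronglyMeasurable _ (Filter.Eventually.of_forall fun b => hb a b)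
    have hi2 : Integrable (fun b => ‖g a - h b‖ ^ 2) (P.map B) :=
      Integrable.of_bound (hs.norm.pow 2).aestronglyMeasurable _
        (Filter.Eventually.of_forall fun b => hb2 a b)
    have h2 : g a = ∫ b, (g a - h b) ∂(P.map B) := by
      rw [integral_sub (integrable_const _) (Integrable.of_bound hh.aestronglyMeasurable _
        (Filter.Eventually.of_forall hhL)), integral_map hB.aemeasurable hh.aestronglyMeasurable,
        h0]
      simp
    calc ‖g a‖ ^ 2 ≤ (∫ b, ‖g a - h b‖ ∂(P.map B)) ^ 2 := by
          refine pow_le_pow_left₀ (norm_nonneg _) ?_ 2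
          nth_rewrite 1 [h2]
          exact norm_integral_le_integral_norm _
      _ ≤ _ := sq_integral_le_integral_sq hi.norm hi2

/-- Symmetrization without an independent copy: the two groups of summands, those with sign `1` and
those with sign `-1`, are independent and centered, so each of them is dominated by their
difference. -/
theorem integral_norm_sum_sq_le [CompleteSpace E] {ι : Type*} [Fintype ι] {α : ι → Type*}
    [∀ l, MeasurableSpace (α l)] {μ : ∀ l, Ω → α l} (hμ : ∀ l, Measurable (μ l))
    (hindep : iIndepFun μ P) {f : ∀ l, α l → E} (hf : ∀ l, StronglyMeasurable (f l)) {K : ℝ}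
    (hK : ∀ l x, ‖f l x‖ ≤ K) (h0 : ∀ l, ∫ ω, f l (μ l ω) ∂P = 0) (ε : ι → ℤˣ) :
    ∫ ω, ‖∑ l, f l (μ l ω)‖ ^ 2 ∂P ≤
      4 * ∫ ω, ‖signedSum (fun l => f l (μ l ω)) ε‖ ^ 2 ∂P := by
  classical
  have hsm : ∀ s : Finset ι, StronglyMeasurable
      fun x : (∀ l : s, α l) => ∑ l : s, f l (x l) := fun s =>
    Finset.stronglyMeasurable_fun_sum _ fun l _ => (hf l).comp_measurable (measurable_pi_apply l)
  have hbd : ∀ (s : Finset ι) (x : ∀ l : s, α l), ‖∑ l : s, f l (x l)‖ ≤ ∑ _l : s, K := fun s x =>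
    norm_sum_le_of_le _ fun l _ => hK l (x l)
  have hint : ∀ l, Integrable (fun ω => f l (μ l ω)) P := fun l =>
    Integrable.of_bound ((hf l).comp_measurable (hμ l)).aestronglyMeasurable K
      (Filter.Eventually.of_forall fun ω => hK l _)
  have hmt : ∀ s : Finset ι, Measurable fun ω (l : s) => μ l ω := fun s =>
    measurable_pi_lambda _ fun l => hμ l
  have h00 : ∀ s : Finset ι, ∫ ω, ∑ l : s, f l (μ l ω) ∂P = 0 := fun s => by
    rw [integral_finsetSum Finset.univ fun (l : s) _ => hint l]
    exact Finset.sum_eq_zero fun l _ => h0 l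
  have key : ∀ s t : Finset ι, Disjoint s t →
      ∫ ω, ‖∑ l ∈ s, f l (μ l ω)‖ ^ 2 ∂P ≤
        ∫ ω, ‖∑ l ∈ s, f l (μ l ω) - ∑ l ∈ t, f l (μ l ω)‖ ^ 2 ∂P := by
    intro s t hst
    have h := integral_norm_sq_le_of_indepFun (hmt s) (hmt t)
      (hindep.indepFun_finset s t hst hμ) (hsm s) (hsm t) (hbd s) (hbd t) (h00 t)
    have hc : ∀ (s : Finset ι) ω, ∑ l : s, f l (μ l ω) = ∑ l ∈ s, f l (μ l ω) := fun s ω =>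
      Finset.sum_coe_sort s fun l => f l (μ l ω)
    simpa only [hc] using h
  let s : Finset ι := Finset.univ.filter fun l => ε l = 1
  have hs1 : ∀ ω, ∑ l, f l (μ l ω) = ∑ l ∈ s, f l (μ l ω) + ∑ l ∈ sᶜ, f l (μ l ω) := fun ω =>
    (Finset.sum_add_sum_compl s _).symm
  have hs2 : ∀ ω, signedSum (fun l => f l (μ l ω)) ε =
      ∑ l ∈ s, f l (μ l ω) - ∑ l ∈ sᶜ, f l (μ l ω) := by
    intro ω
    rw [signedSum, ← Finset.sum_add_sum_compl s, sub_eq_add_neg, ← Finset.sum_neg_distrib]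
    congr 1
    · refine Finset.sum_congr rfl fun l hl => ?_
      have : ε l = 1 := by simpa [s] using hl
      simp [this]
    · refine Finset.sum_congr rfl fun l hl => ?_
      have h : ε l = -1 := (Int.units_eq_one_or _).resolve_left (by simpa [s] using hl)
      simp [h]
  have hi2 : ∀ t : Finset ι, Integrable (fun ω => ‖∑ l ∈ t, f l (μ l ω)‖ ^ 2) P := fun t => by
    refine Integrable.of_bound ((Finset.stronglyMeasurable_fun_sum _ fun l _ =>
      (hf l).comp_measurable (hμ l)).norm.pow 2).aestronglyMeasurable ((∑ _l ∈ t, K) ^ 2)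
      (Filter.Eventually.of_forall fun ω => ?_)
    rw [norm_pow, norm_norm]
    exact pow_le_pow_left₀ (norm_nonneg _) (norm_sum_le_of_le _ fun l _ => hK l _) 2
  have ha := key s sᶜ disjoint_compl_right
  have hb := key sᶜ s disjoint_compl_left
  simp_rw [norm_sub_rev (∑ l ∈ sᶜ, f l (μ l _))] at hb
  simp_rw [hs2]
  calc ∫ ω, ‖∑ l, f l (μ l ω)‖ ^ 2 ∂P
      ≤ ∫ ω, (2 * ‖∑ l ∈ s, f l (μ l ω)‖ ^ 2 + 2 * ‖∑ l ∈ sᶜ, f l (μ l ω)‖ ^ 2) ∂P := by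
        refine integral_mono (hi2 Finset.univ) (((hi2 s).const_mul 2).add ((hi2 sᶜ).const_mul 2))
          fun ω => ?_
        simp only [hs1]
        have h1 := norm_add_le (∑ l ∈ s, f l (μ l ω)) (∑ l ∈ sᶜ, f l (μ l ω))
        have h2 := pow_le_pow_left₀ (norm_nonneg _) h1 2
        nlinarith [sq_nonneg (‖∑ l ∈ s, f l (μ l ω)‖ - ‖∑ l ∈ sᶜ, f l (μ l ω)‖)]
    _ = 2 * ∫ ω, ‖∑ l ∈ s, f l (μ l ω)‖ ^ 2 ∂P + 2 * ∫ ω, ‖∑ l ∈ sᶜ, f l (μ l ω)‖ ^ 2 ∂P := by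
        rw [integral_add ((hi2 s).const_mul 2) ((hi2 sᶜ).const_mul 2), integral_const_mul,
          integral_const_mul]
    _ ≤ _ := by linarith

end Symmetrization

/-! ### The Hilbert-Schmidt norm -/

section HilbertSchmidt

variable {H : Type*} [NormedAddCommGroup H] [InnerProductSpace ℝ H] [CompleteSpace H]

/-- The restriction of an operator to finitely many vectors of the fixed orthonormal basis. The
supremum over `s` of `‖hsEval s T‖` is the Hilbert-Schmidt norm of `T`, so a bound for that norm that
is uniform in `s` passes to sums and to Bochner integrals of operators. -/
noncomputable def hsEval (s : Finset (basisSet H)) : (H →L[ℝ] H) →L[ℝ] PiLp 2 fun _ : s => H :=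
  (PiLp.continuousLinearEquiv 2 ℝ fun _ : s => H).symm.toContinuousLinearMap ∘L
    ContinuousLinearMap.pi fun i : s => ContinuousLinearMap.apply ℝ H (stdBasis H i)

theorem norm_hsEval_sq (s : Finset (basisSet H)) (T : H →L[ℝ] H) :
    ‖hsEval s T‖ ^ 2 = ∑ i ∈ s, ‖T (stdBasis H i)‖ ^ 2 := by
  rw [PiLp.norm_sq_eq_of_L2, ← Finset.sum_coe_sort s]
  rfl

theorem posTrace_eq_iSup (T : H →L[ℝ] H) :
    posTrace (ContinuousLinearMap.adjoint T ∘L T) =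
      ⨆ s : Finset (basisSet H), ENNReal.ofReal (‖hsEval s T‖ ^ 2) := by
  rw [posTrace_adjoint_comp_self (stdBasis H), ENNReal.tsum_eq_iSup_sum]
  simp_rw [norm_hsEval_sq, ENNReal.ofReal_sum_of_nonneg fun i _ => sq_nonneg _]

theorem posTrace_le_of_norm_hsEval_le {T : H →L[ℝ] H} {c : ℝ} (h : ∀ s, ‖hsEval s T‖ ≤ c) :
    posTrace (ContinuousLinearMap.adjoint T ∘L T) ≤ ENNReal.ofReal (c ^ 2) := by
  rw [posTrace_eq_iSup]
  exact iSup_le fun s => ENNReal.ofReal_le_ofReal (pow_le_pow_left₀ (norm_nonneg _) (h s) 2)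

theorem lowerSemicontinuous_posTrace :
    LowerSemicontinuous fun T : H →L[ℝ] H =>
      posTrace (ContinuousLinearMap.adjoint T ∘L T) := by
  simp_rw [posTrace_eq_iSup]
  exact lowerSemicontinuous_iSup fun s => Continuous.lowerSemicontinuous
    (ENNReal.continuous_ofReal.comp (by fun_prop))

end HilbertSchmidt

/-! ### Integral operators -/

section IntegralOperators

variable {α : Type*} [MeasurableSpace α] {ν : Measure α}

theorem norm_sq_eq_integral (φ : Lp ℝ 2 ν) : ‖φ‖ ^ 2 = ∫ x, φ x ^ 2 ∂ν := by
  rw [← real_inner_self_eq_norm_sq, L2.inner_def]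
  simp [sq]

theorem integrable_coe_sq (φ : Lp ℝ 2 ν) : Integrable (fun x => φ x ^ 2) ν :=
  (Lp.memLp φ).integrable_sq

/-- Bessel's inequality bounds the Hilbert-Schmidt norm of an integral operator by the `L²` norm of
its kernel. -/
theorem sum_norm_sq_le_of_kernel [IsFiniteMeasure ν] {B : Lp ℝ 2 ν →L[ℝ] Lp ℝ 2 ν}
    {k : α → α → ℝ} (hB : ∀ φ, B φ =ᵐ[ν] fun x => ∫ y, k x y * φ y ∂ν) {c : ℝ}
    (hk : ∀ᵐ x ∂ν, MemLp (k x) 2 ν) (hc : ∀ᵐ x ∂ν, ∫ y, k x y ^ 2 ∂ν ≤ c)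
    {κ : Type*} {e : κ → Lp ℝ 2 ν} (he : Orthonormal ℝ e) (s : Finset κ) :
    ∑ i ∈ s, ‖B (e i)‖ ^ 2 ≤ c * ν.real univ := by
  simp_rw [norm_sq_eq_integral]
  rw [← integral_finsetSum _ fun i _ => integrable_coe_sq _]
  have h1 : ∫ _x, c ∂ν = c * ν.real univ := by rw [integral_const, smul_eq_mul, mul_comm]
  rw [← h1]
  refine integral_mono_ae (integrable_finsetSum _ fun i _ => integrable_coe_sq _)
    (integrable_const _) ?_
  have h2 : ∀ᵐ x ∂ν, ∀ i ∈ s, B (e i) x = ∫ y, k x y * e i y ∂ν :=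
    (Finset.eventually_all s).2 fun i _ => hB (e i)
  filter_upwards [hk, hc, h2] with x hkx hcx hx
  have h3 : ∀ i, ∫ y, k x y * e i y ∂ν = inner ℝ (e i) (hkx.toLp (k x)) := by
    intro i
    rw [L2.inner_def]
    refine integral_congr_ae ?_
    filter_upwards [hkx.coeFn_toLp] with y hy
    simp [hy]
  have h4 : ‖hkx.toLp (k x)‖ ^ 2 = ∫ y, k x y ^ 2 ∂ν := by
    rw [norm_sq_eq_integral]
    refine integral_congr_ae ?_
    filter_upwards [hkx.coeFn_toLp] with y hy
    simp [hy]
  have h5 := he.sum_inner_products_le (hkx.toLp (k x)) (s := s)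
  rw [h4] at h5
  refine le_trans (le_of_eq (Finset.sum_congr rfl fun i hi => ?_)) (h5.trans hcx)
  rw [hx i hi, h3, Real.norm_eq_abs, sq_abs]

theorem norm_le_of_kernel [IsFiniteMeasure ν] {B : Lp ℝ 2 ν →L[ℝ] Lp ℝ 2 ν}
    {k : α → α → ℝ} (hB : ∀ φ, B φ =ᵐ[ν] fun x => ∫ y, k x y * φ y ∂ν) {c : ℝ}
    (hk : ∀ᵐ x ∂ν, MemLp (k x) 2 ν) (hc : ∀ᵐ x ∂ν, ∫ y, k x y ^ 2 ∂ν ≤ c) :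
    ‖B‖ ≤ Real.sqrt (c * ν.real univ) := by
  refine ContinuousLinearMap.opNorm_le_of_unit_norm (Real.sqrt_nonneg _) fun φ hφ => ?_
  refine Real.le_sqrt_of_sq_le ?_
  have he : Orthonormal ℝ fun _ : Unit => φ :=
    ⟨fun _ => hφ, fun i j hij => (hij (Subsingleton.elim i j)).elim⟩
  simpa using sum_norm_sq_le_of_kernel hB hk hc he Finset.univ

theorem enorm_rpow_two_eq_lintegral (φ : Lp ℝ 2 ν) :
    ‖φ‖ₑ ^ (2 : ℝ) = ∫⁻ x, ‖φ x‖ₑ ^ (2 : ℝ) ∂ν := by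
  rw [Lp.enorm_def, eLpNorm_eq_lintegral_rpow_enorm_toReal (by norm_num) (by norm_num),
    ← ENNReal.rpow_mul]
  norm_num

theorem lintegral_mul_rpow_two_le {G g : α → ℝ≥0∞} (hG : AEMeasurable G ν)
    (hg : AEMeasurable g ν) :
    (∫⁻ y, G y * g y ∂ν) ^ (2 : ℝ) ≤ (∫⁻ y, G y ∂ν) * ∫⁻ y, G y * g y ^ (2 : ℝ) ∂ν := by
  have h := ENNReal.lintegral_mul_le_Lp_mul_Lq ν Real.HolderConjugate.two_two
    (hG.pow_const (1 / 2 : ℝ)) ((hG.pow_const (1 / 2 : ℝ)).mul hg)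
  have h1 : ∀ y, G y ^ (1 / 2 : ℝ) * (G y ^ (1 / 2 : ℝ) * g y) = G y * g y := fun y => by
    rw [← mul_assoc, ← ENNReal.rpow_add_of_nonneg _ _ (by norm_num) (by norm_num)]
    norm_num
  have h2 : ∀ y, (G y ^ (1 / 2 : ℝ)) ^ (2 : ℝ) = G y := fun y => by
    rw [← ENNReal.rpow_mul]; norm_num
  simp only [Pi.mul_apply, h1, h2, ENNReal.mul_rpow_of_nonneg _ _ zero_le_two] at h
  refine (ENNReal.rpow_le_rpow h zero_le_two).trans_eq ?_
  rw [ENNReal.mul_rpow_of_nonneg _ _ zero_le_two, ← ENNReal.rpow_mul, ← ENNReal.rpow_mul]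
  norm_num

/-- Schur's test for a kernel dominated by a symmetric one. -/
theorem norm_le_of_schur [SFinite ν] {B : Lp ℝ 2 ν →L[ℝ] Lp ℝ 2 ν} {k : α → α → ℝ}
    (hB : ∀ φ, B φ =ᵐ[ν] fun x => ∫ y, k x y * φ y ∂ν) {G : α → α → ℝ≥0∞}
    (hG : Measurable fun p : α × α => G p.1 p.2) (hsymm : ∀ x y, G x y = G y x)
    (hk : ∀ᵐ x ∂ν, ∀ᵐ y ∂ν, ‖k x y‖ₑ ≤ G x y) {c : ℝ} (hc0 : 0 ≤ c)
    (hc : ∀ x, ∫⁻ y, G x y ∂ν ≤ ENNReal.ofReal c) : ‖B‖ ≤ c := by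
  refine ContinuousLinearMap.opNorm_le_bound _ hc0 fun φ => ?_
  have hφm : Measurable fun x => ‖φ x‖ₑ := (Lp.stronglyMeasurable φ).measurable.enorm
  have h1 : ‖B φ‖ₑ ^ (2 : ℝ) ≤ (ENNReal.ofReal c * ‖φ‖ₑ) ^ (2 : ℝ) :=
    calc ‖B φ‖ₑ ^ (2 : ℝ) = ∫⁻ x, ‖B φ x‖ₑ ^ (2 : ℝ) ∂ν := enorm_rpow_two_eq_lintegral _
      _ ≤ ∫⁻ x, ENNReal.ofReal c * ∫⁻ y, G x y * ‖φ y‖ₑ ^ (2 : ℝ) ∂ν ∂ν := by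
          refine lintegral_mono_ae ?_
          filter_upwards [hB φ, hk] with x hx hkx
          have h2 : ‖B φ x‖ₑ ≤ ∫⁻ y, G x y * ‖φ y‖ₑ ∂ν := by
            rw [hx]
            refine (enorm_integral_le_lintegral_enorm _).trans (lintegral_mono_ae ?_)
            filter_upwards [hkx] with y hy
            rw [enorm_mul]
            gcongr
          refine (ENNReal.rpow_le_rpow h2 zero_le_two).trans ?_
          refine (lintegral_mul_rpow_two_le (hG.of_uncurry_left (f := G)).aemeasurable
            hφm.aemeasurable).trans ?_
          gcongr
          exact hc x
      _ = ENNReal.ofReal c * ∫⁻ y, (∫⁻ x, G x y ∂ν) * ‖φ y‖ₑ ^ (2 : ℝ) ∂ν := by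
          have hm : Measurable fun p : α × α => G p.1 p.2 * ‖φ p.2‖ₑ ^ (2 : ℝ) :=
            hG.mul ((hφm.comp measurable_snd).pow_const 2)
          rw [lintegral_const_mul _ hm.lintegral_prod_right', lintegral_lintegral_swap hm.aemeasurable]
          congr 1
          refine lintegral_congr fun y => ?_
          change ∫⁻ x, G x y * ‖φ y‖ₑ ^ (2 : ℝ) ∂ν = _
          rw [lintegral_mul_const _ (hG.of_uncurry_right (f := G))]
      _ ≤ ENNReal.ofReal c * ∫⁻ y, ENNReal.ofReal c * ‖φ y‖ₑ ^ (2 : ℝ) ∂ν := by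
          gcongr with y
          simp_rw [fun x => hsymm x y]
          exact hc y
      _ = (ENNReal.ofReal c * ‖φ‖ₑ) ^ (2 : ℝ) := by
          rw [lintegral_const_mul _ (hφm.pow_const 2), ← enorm_rpow_two_eq_lintegral,
            ENNReal.mul_rpow_of_nonneg _ _ zero_le_two, ← mul_assoc]
          congr 1
          norm_num [sq]
  have h2 := (ENNReal.rpow_le_rpow_iff (by norm_num : (0 : ℝ) < 2)).1 h1
  have h3 := ENNReal.toReal_mono (ENNReal.mul_ne_top ENNReal.ofReal_ne_top enorm_ne_top) h2
  simpa [ENNReal.toReal_ofReal hc0] using h3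

end IntegralOperators

/-! ### Estimates for the solution operators -/

theorem integrable_exp_neg_mul_abs {a : ℝ} (ha : 0 < a) :
    Integrable fun t : ℝ => Real.exp (-(a * |t|)) := by
  rw [← integrableOn_univ, ← Iic_union_Ioi (a := (0 : ℝ))]
  refine IntegrableOn.union ?_ ?_
  · refine (integrableOn_exp_mul_Iic ha 0).congr_fun (fun t ht => ?_) measurableSet_Iic
    rw [abs_of_nonpos ht]
    ring_nf
  · refine (integrableOn_exp_mul_Ioi (neg_lt_zero.2 ha) 0).congr_fun (fun t ht => ?_)
      measurableSet_Ioi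
    simp only [abs_of_pos (mem_Ioi.1 ht)]
    ring_nf

theorem lintegral_exp_neg_mul_abs {a : ℝ} (ha : 0 < a) :
    ∫⁻ t : ℝ, ENNReal.ofReal (a * Real.exp (-(a * |t|))) = ENNReal.ofReal 2 := by
  rw [← ofReal_integral_eq_lintegral_ofReal ((integrable_exp_neg_mul_abs ha).const_mul a)
    (Filter.Eventually.of_forall fun t => by positivity), integral_const_mul,
    integral_comp_abs (f := fun t => Real.exp (-(a * t)))]
  simp_rw [← neg_mul]
  rw [integral_exp_mul_Ioi (neg_lt_zero.2 ha)]
  congr 1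
  field_simp
  simp

/-- The function `t ↦ t exp (-t d)` is 1-Lipschitz on `[0, ∞)` for every `d ≥ 0`. -/
theorem abs_mul_exp_sub_le {a b d : ℝ} (ha : 0 ≤ a) (hb : 0 ≤ b) (hd : 0 ≤ d) :
    |a * Real.exp (-(a * d)) - b * Real.exp (-(b * d))| ≤ |a - b| := by
  wlog hab : b ≤ a generalizing a b
  · rw [abs_sub_comm, abs_sub_comm a]
    exact this hb ha (le_of_not_ge hab)
  rw [abs_of_nonneg (sub_nonneg.2 hab)]
  have h1 : Real.exp (-(b * d)) ≤ 1 := Real.exp_le_one_iff.2 (by nlinarith [mul_nonneg hb hd])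
  have h1' : Real.exp (-(a * d)) ≤ 1 := Real.exp_le_one_iff.2 (by nlinarith [mul_nonneg ha hd])
  have h2 : Real.exp (-(a * d)) ≤ Real.exp (-(b * d)) :=
    Real.exp_le_exp.2 (neg_le_neg (mul_le_mul_of_nonneg_right hab hd))
  have hpos := Real.exp_pos (-(a * d))
  have hposb := Real.exp_pos (-(b * d))
  refine abs_le.2 ⟨?_, ?_⟩
  · have h3 : Real.exp (-(a * d)) = Real.exp (-(b * d)) * Real.exp (-((a - b) * d)) := by
      rw [← Real.exp_add]; ring_nf
    have h4 := Real.add_one_le_exp (-((a - b) * d))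
    have h5 : b * d * Real.exp (-(b * d)) ≤ 1 :=
      (Real.mul_exp_neg_le_exp_neg_one (b * d)).trans (Real.exp_le_one_iff.2 (by norm_num))
    have h6 : b * Real.exp (-(b * d)) - b * Real.exp (-(a * d)) ≤ a - b := by
      have h7 : b * Real.exp (-(b * d)) - b * Real.exp (-(a * d)) =
          b * Real.exp (-(b * d)) * (1 - Real.exp (-((a - b) * d))) := by rw [h3]; ring
      rw [h7]
      calc b * Real.exp (-(b * d)) * (1 - Real.exp (-((a - b) * d)))
          ≤ b * Real.exp (-(b * d)) * ((a - b) * d) := by gcongr; linarith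
        _ = (a - b) * (b * d * Real.exp (-(b * d))) := by ring
        _ ≤ (a - b) * 1 := mul_le_mul_of_nonneg_left h5 (sub_nonneg.2 hab)
        _ = a - b := mul_one _
    nlinarith [mul_nonneg (sub_nonneg.2 hab) hpos.le]
  · nlinarith [mul_nonneg hb (sub_nonneg.2 h2), mul_nonneg ha (sub_nonneg.2 h2)]

namespace Slab

variable (M : Slab)

/-- The optical depth `∫ sigmaT` between `xL` and `x`. -/
noncomputable def depth (x : ℝ) : ℝ := ∫ z in M.xL..x, M.cutT z

theorem continuous_depth : Continuous M.depth :=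
  intervalIntegral.continuous_primitive (fun _ _ => M.integrable_cutT.intervalIntegrable) M.xL

theorem depth_sub (x y : ℝ) : M.depth x - M.depth y = ∫ z in y..x, M.cutT z :=
  intervalIntegral.integral_interval_sub_left M.integrable_cutT.intervalIntegrable
    M.integrable_cutT.intervalIntegrable

theorem depth_xL : M.depth M.xL = 0 := intervalIntegral.integral_same

theorem strictMonoOn_depth : StrictMonoOn M.depth (Icc M.xL M.xR) := by
  intro x hx y hy hxy
  obtain ⟨c, hc, hc'⟩ := M.sigmaT_lower
  have h : ∫ _z in x..y, c ≤ ∫ z in x..y, M.cutT z := by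
    refine intervalIntegral.integral_mono_on hxy.le (by simp)
      M.integrable_cutT.intervalIntegrable fun z hz => ?_
    have hz' : z ∈ Icc M.xL M.xR := ⟨hx.1.trans hz.1, hz.2.trans hy.2⟩
    rw [cutT, indicator_of_mem hz']
    exact hc' z hz'
  rw [← M.depth_sub, intervalIntegral.integral_const, smul_eq_mul] at h
  nlinarith [mul_pos (sub_pos.2 hxy) hc]

theorem depth_nonneg {x : ℝ} (hx : x ∈ Icc M.xL M.xR) : 0 ≤ M.depth x := by
  rw [← M.depth_xL]
  exact M.strictMonoOn_depth.monotoneOn (left_mem_Icc.2 M.xL_lt_xR.le) hx hx.1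

theorem weight_Icc {a : ℝ} (ha : a ∈ Icc M.xL M.xR) :
    M.weight (Icc M.xL a) = ENNReal.ofReal (M.depth a) := by
  obtain ⟨c, hc, hc'⟩ := M.sigmaT_lower
  have hsub : Icc M.xL a ⊆ Icc M.xL M.xR := Icc_subset_Icc_right ha.2
  have hnn : 0 ≤ᵐ[volume.restrict (Icc M.xL a)] M.cutT := by
    filter_upwards [ae_restrict_mem measurableSet_Icc] with z hz
    rw [cutT, indicator_of_mem (hsub hz)]
    exact hc.le.trans (hc' z (hsub hz))
  rw [weight, withDensity_apply _ measurableSet_Icc, Measure.restrict_restrict measurableSet_Icc,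
    inter_eq_self_of_subset_left hsub, depth, intervalIntegral.integral_of_le ha.1,
    ← integral_Icc_eq_integral_Ioc,
    ofReal_integral_eq_lintegral_ofReal M.integrable_cutT.integrableOn hnn]
  refine setLIntegral_congr_fun measurableSet_Icc fun z hz => ?_
  simp only [cutT, indicator_of_mem (hsub hz)]

/-- In the optical depth variable, the measure `sigmaT dx` becomes the Lebesgue measure. -/
theorem map_depth_weight :
    M.weight.map M.depth = volume.restrict (Icc 0 (M.depth M.xR)) := by
  have hm := M.continuous_depth.measurable
  have hR : M.xR ∈ Icc M.xL M.xR := right_mem_Icc.2 M.xL_lt_xR.le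
  refine Measure.ext_of_Iic _ _ fun t => ?_
  rw [Measure.map_apply hm measurableSet_Iic, Measure.restrict_apply measurableSet_Iic]
  rcases lt_or_ge t 0 with ht | ht
  · have h1 : M.weight (M.depth ⁻¹' Iic t) = 0 := by
      rw [measure_eq_zero_iff_ae_notMem]
      filter_upwards [M.ae_mem] with x hx hxt
      exact absurd (M.depth_nonneg hx) (not_le.2 (lt_of_le_of_lt hxt ht))
    have h2 : Iic t ∩ Icc 0 (M.depth M.xR) = ∅ := by
      ext z
      simp only [mem_inter_iff, mem_Iic, mem_Icc, mem_empty_iff_false, iff_false]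
      intro hz
      linarith [hz.1, hz.2.1]
    rw [h1, h2, measure_empty]
  · obtain ⟨a, ha, hat⟩ : ∃ a ∈ Icc M.xL M.xR, M.depth a = min t (M.depth M.xR) := by
      have h := intermediate_value_Icc M.xL_lt_xR.le M.continuous_depth.continuousOn
      have h' : min t (M.depth M.xR) ∈ Icc (M.depth M.xL) (M.depth M.xR) := by
        rw [M.depth_xL]
        exact ⟨le_min ht (M.depth_nonneg hR), min_le_right _ _⟩
      exact h h'
    have h1 : M.weight (M.depth ⁻¹' Iic t) = M.weight (Icc M.xL a) := by
      refine measure_congr ?_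
      filter_upwards [M.ae_mem] with x hx
      refine propext ?_
      change M.depth x ≤ t ↔ M.xL ≤ x ∧ x ≤ a
      rw [← M.strictMonoOn_depth.le_iff_le hx ha, hat, le_min_iff]
      exact ⟨fun h => ⟨hx.1, h, M.strictMonoOn_depth.monotoneOn hx hR hx.2⟩, fun h => h.2.1⟩
    have h2 : Iic t ∩ Icc 0 (M.depth M.xR) = Icc 0 (M.depth a) := by
      ext z
      simp only [mem_inter_iff, mem_Iic, mem_Icc, hat, le_min_iff]
      tauto
    rw [h1, h2, M.weight_Icc ha, Real.volume_Icc, sub_zero]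

/-- The symmetric kernel that dominates `kernel μ` for `a = 1 / |μ|`. -/
noncomputable def expKernel (a x y : ℝ) : ℝ :=
  a * Real.exp (-(a * |M.depth x - M.depth y|))

theorem measurable_expKernel (a : ℝ) : Measurable fun p : ℝ × ℝ => M.expKernel a p.1 p.2 := by
  have := M.continuous_depth.measurable
  unfold expKernel
  fun_prop

theorem expKernel_comm (a x y : ℝ) : M.expKernel a x y = M.expKernel a y x := by
  rw [expKernel, expKernel, abs_sub_comm]

theorem expKernel_nonneg {a : ℝ} (ha : 0 ≤ a) (x y : ℝ) : 0 ≤ M.expKernel a x y :=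
  mul_nonneg ha (Real.exp_nonneg _)

theorem lintegral_expKernel_le {a : ℝ} (ha : 0 ≤ a) (x : ℝ) :
    ∫⁻ y, ENNReal.ofReal (M.expKernel a x y) ∂M.weight ≤ ENNReal.ofReal 2 := by
  rcases ha.eq_or_lt with rfl | ha
  · simp [expKernel]
  have hg : Measurable fun t : ℝ =>
      ENNReal.ofReal (a * Real.exp (-(a * |M.depth x - t|))) := by fun_prop
  calc ∫⁻ y, ENNReal.ofReal (M.expKernel a x y) ∂M.weight
      = ∫⁻ t, ENNReal.ofReal (a * Real.exp (-(a * |M.depth x - t|))) ∂(M.weight.map M.depth) :=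
        (lintegral_map hg M.continuous_depth.measurable).symm
    _ ≤ ∫⁻ t, ENNReal.ofReal (a * Real.exp (-(a * |M.depth x - t|))) := by
        rw [M.map_depth_weight]
        exact lintegral_mono' Measure.restrict_le_self le_rfl
    _ = ∫⁻ t, ENNReal.ofReal (a * Real.exp (-(a * |t|))) :=
        lintegral_sub_left_eq_self (fun t => ENNReal.ofReal (a * Real.exp (-(a * |t|)))) _
    _ = ENNReal.ofReal 2 := lintegral_exp_neg_mul_abs ha

theorem integral_sigmaT_eq_depth {x y : ℝ} (hx : x ∈ Icc M.xL M.xR) (hy : y ∈ Icc M.xL M.xR) :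
    ∫ z in y..x, M.sigmaT z = M.depth x - M.depth y := by
  rw [M.depth_sub, M.integral_cutT hy hx]

theorem kernel_of_pos {μ x y : ℝ} (hμ : 0 < μ) (hx : x ∈ Icc M.xL M.xR)
    (hy : y ∈ Icc M.xL M.xR) : M.kernel μ x y =
      if y ≤ x then M.expKernel |μ|⁻¹ x y * (M.sigmaR y / M.sigmaT y) else 0 := by
  unfold kernel expKernel
  rw [if_pos hμ]
  split_ifs with h
  · have h1 := M.strictMonoOn_depth.monotoneOn hy hx h
    rw [M.integral_sigmaT_eq_depth hx hy, abs_of_pos hμ, abs_of_nonneg (sub_nonneg.2 h1), one_div,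
      neg_mul]
  · rfl

theorem kernel_of_neg {μ x y : ℝ} (hμ : μ < 0) (hx : x ∈ Icc M.xL M.xR)
    (hy : y ∈ Icc M.xL M.xR) : M.kernel μ x y =
      if x ≤ y then M.expKernel |μ|⁻¹ x y * (M.sigmaR y / M.sigmaT y) else 0 := by
  unfold kernel expKernel
  rw [if_neg hμ.not_gt, if_pos hμ]
  split_ifs with h
  · have h1 := M.strictMonoOn_depth.monotoneOn hx hy h
    rw [M.integral_sigmaT_eq_depth hy hx, abs_of_neg hμ, abs_of_nonpos (sub_nonpos.2 h1), one_div,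
      inv_neg]
    ring_nf
  · rfl

theorem kernel_zero (x y : ℝ) : M.kernel 0 x y = 0 := by simp [kernel]

theorem abs_kernel_le_expKernel (μ : ℝ) {x y : ℝ} (hx : x ∈ Icc M.xL M.xR)
    (hy : y ∈ Icc M.xL M.xR) (hr : |M.sigmaR y / M.sigmaT y| ≤ 1) :
    |M.kernel μ x y| ≤ M.expKernel |μ|⁻¹ x y := by
  have h0 : 0 ≤ M.expKernel |μ|⁻¹ x y := M.expKernel_nonneg (by positivity) x y
  have h1 : |M.expKernel |μ|⁻¹ x y * (M.sigmaR y / M.sigmaT y)| ≤ M.expKernel |μ|⁻¹ x y := by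
    rw [abs_mul, abs_of_nonneg h0]
    exact mul_le_of_le_one_right h0 hr
  rcases lt_trichotomy μ 0 with h | h | h
  · rw [M.kernel_of_neg h hx hy]
    split_ifs
    · exact h1
    · simpa using h0
  · rw [h] at h0 ⊢
    rw [kernel_zero]
    simpa using h0
  · rw [M.kernel_of_pos h hx hy]
    split_ifs
    · exact h1
    · simpa using h0

theorem abs_kernel_sub_le {μ ν x y : ℝ} (hμν : 0 < μ * ν) (hx : x ∈ Icc M.xL M.xR)
    (hy : y ∈ Icc M.xL M.xR) (hr : |M.sigmaR y / M.sigmaT y| ≤ 1) :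
    |M.kernel μ x y - M.kernel ν x y| ≤ |(|μ|⁻¹ - |ν|⁻¹)| := by
  have h1 : |M.expKernel |μ|⁻¹ x y * (M.sigmaR y / M.sigmaT y) -
      M.expKernel |ν|⁻¹ x y * (M.sigmaR y / M.sigmaT y)| ≤ |(|μ|⁻¹ - |ν|⁻¹)| := by
    rw [← sub_mul, abs_mul]
    refine (mul_le_of_le_one_right (abs_nonneg _) hr).trans ?_
    exact abs_mul_exp_sub_le (by positivity) (by positivity) (abs_nonneg _)
  rcases pos_and_pos_or_neg_and_neg_of_mul_pos hμν with ⟨h, h'⟩ | ⟨h, h'⟩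
  · rw [M.kernel_of_pos h hx hy, M.kernel_of_pos h' hx hy]
    split_ifs
    · exact h1
    · simp
  · rw [M.kernel_of_neg h hx hy, M.kernel_of_neg h' hx hy]
    split_ifs
    · exact h1
    · simp

theorem aestronglyMeasurable_kernel (μ : ℝ) {x : ℝ} (hx : x ∈ Icc M.xL M.xR) :
    AEStronglyMeasurable (M.kernel μ x) M.weight := by
  have h : Measurable fun y => M.cutKernel μ x y :=
    M.measurable_cutKernel.comp (by fun_prop : Measurable fun y : ℝ => (μ, x, y))
  refine h.aestronglyMeasurable.congr ?_
  filter_upwards [M.ae_mem] with y hy using M.cutKernel_eq hx hy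

theorem memLp_kernel (μ : ℝ) {x : ℝ} (hx : x ∈ Icc M.xL M.xR) :
    MemLp (M.kernel μ x) 2 M.weight := by
  refine MemLp.of_bound (M.aestronglyMeasurable_kernel μ hx) |1 / μ| ?_
  filter_upwards [M.ae_mem, M.ae_abs_ratio_le] with y hy hr
  exact M.abs_kernel_le hx hy hr

/-- Schur's test in the optical depth variable, where the dominating kernel is a convolution kernel of
mass 2. -/
theorem norm_solOp_le (μ : ℝ) : ‖M.solOp μ‖ ≤ 2 := by
  refine norm_le_of_schur (M.coeFn_solOp μ)
    (G := fun x y => ENNReal.ofReal (M.expKernel |μ|⁻¹ x y))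
    (M.measurable_expKernel _).ennreal_ofReal (fun x y => by rw [M.expKernel_comm]) ?_ zero_le_two
    (M.lintegral_expKernel_le (by positivity))
  filter_upwards [M.ae_mem] with x hx
  filter_upwards [M.ae_mem, M.ae_abs_ratio_le] with y hy hr
  rw [Real.enorm_eq_ofReal_abs]
  exact ENNReal.ofReal_le_ofReal (M.abs_kernel_le_expKernel μ hx hy hr)

theorem expKernel_le {a : ℝ} (ha : 0 ≤ a) (x y : ℝ) : M.expKernel a x y ≤ a :=
  mul_le_of_le_one_right ha (Real.exp_le_one_iff.2 (neg_nonpos.2 (by positivity)))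

theorem integrable_expKernel {a : ℝ} (ha : 0 ≤ a) (x : ℝ) :
    Integrable (fun y => M.expKernel a x y) M.weight := by
  have hm : Measurable fun y => M.expKernel a x y := by
    have := M.continuous_depth.measurable
    unfold expKernel
    fun_prop
  refine Integrable.of_bound hm.aestronglyMeasurable a (Filter.Eventually.of_forall fun y => ?_)
  rw [Real.norm_of_nonneg (M.expKernel_nonneg ha x y)]
  exact M.expKernel_le ha x y

theorem integral_expKernel_le {a : ℝ} (ha : 0 ≤ a) (x : ℝ) :
    ∫ y, M.expKernel a x y ∂M.weight ≤ 2 := by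
  rw [integral_eq_lintegral_of_nonneg_ae
    (Filter.Eventually.of_forall fun y => M.expKernel_nonneg ha x y)
    (M.integrable_expKernel ha x).aestronglyMeasurable]
  exact ENNReal.toReal_le_of_le_ofReal zero_le_two (M.lintegral_expKernel_le ha x)

theorem integral_kernel_sq_le (μ : ℝ) {x : ℝ} (hx : x ∈ Icc M.xL M.xR) :
    ∫ y, M.kernel μ x y ^ 2 ∂M.weight ≤ 2 * |μ|⁻¹ := by
  have ha : 0 ≤ |μ|⁻¹ := by positivity
  have h1 : ∀ᵐ y ∂M.weight, M.kernel μ x y ^ 2 ≤ |μ|⁻¹ * M.expKernel |μ|⁻¹ x y := by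
    filter_upwards [M.ae_mem, M.ae_abs_ratio_le] with y hy hr
    have h2 := M.abs_kernel_le_expKernel μ hx hy hr
    rw [← sq_abs, sq]
    exact mul_le_mul (h2.trans (M.expKernel_le ha x y)) h2 (abs_nonneg _) ha
  refine (integral_mono_ae (M.memLp_kernel μ hx).integrable_sq
    ((M.integrable_expKernel ha x).const_mul _) h1).trans ?_
  rw [integral_const_mul, mul_comm]
  exact mul_le_mul_of_nonneg_right (M.integral_expKernel_le ha x) ha

/-- The Hilbert-Schmidt norm of `A_μ` is of order `|μ|^(-1/2)`, which is integrable at `μ = 0`. -/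
theorem norm_hsEval_solOp_le (μ : ℝ) (s : Finset (basisSet M.L2)) :
    ‖hsEval s (M.solOp μ)‖ ≤ Real.sqrt (2 * M.weight.real univ) * Real.sqrt |μ|⁻¹ := by
  rw [← Real.sqrt_mul (by positivity)]
  refine Real.le_sqrt_of_sq_le ?_
  rw [norm_hsEval_sq]
  refine (sum_norm_sq_le_of_kernel (M.coeFn_solOp μ) (c := 2 * |μ|⁻¹) ?_ ?_
    (stdBasis M.L2).orthonormal s).trans_eq (by ring)
  · filter_upwards [M.ae_mem] with x hx using M.memLp_kernel μ hx
  · filter_upwards [M.ae_mem] with x hx using M.integral_kernel_sq_le μ hx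

/-- Between velocities of the same sign the kernel is a Lipschitz function of `1 / |μ|`, uniformly in
`x` and `y`. -/
theorem norm_solOp_sub_le {μ ν : ℝ} (hμν : 0 < μ * ν) :
    ‖M.solOp μ - M.solOp ν‖ ≤ |(|μ|⁻¹ - |ν|⁻¹)| * M.weight.real univ := by
  set d := |(|μ|⁻¹ - |ν|⁻¹)| with hd
  have hd0 : 0 ≤ d := abs_nonneg _
  have h := norm_le_of_kernel (B := M.solOp μ - M.solOp ν)
    (k := fun x y => M.kernel μ x y - M.kernel ν x y) (c := d ^ 2 * M.weight.real univ) ?_ ?_ ?_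
  · refine h.trans_eq ?_
    rw [mul_assoc, ← sq, ← mul_pow, Real.sqrt_sq (by positivity)]
  · intro φ
    filter_upwards [M.ae_mem, M.coeFn_solOp μ φ, M.coeFn_solOp ν φ,
      Lp.coeFn_sub (M.solOp μ φ) (M.solOp ν φ)] with x hx h1 h2 h3
    rw [sub_apply, h3, Pi.sub_apply, h1, h2,
      ← integral_sub (M.integrable_kernel_mul μ hx (M.integrable_coe φ))
        (M.integrable_kernel_mul ν hx (M.integrable_coe φ))]
    simp only [sub_mul]
  · filter_upwards [M.ae_mem] with x hx using (M.memLp_kernel μ hx).sub (M.memLp_kernel ν hx)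
  · filter_upwards [M.ae_mem] with x hx
    have h1 : ∫ _y, d ^ 2 ∂M.weight = d ^ 2 * M.weight.real univ := by
      rw [integral_const, smul_eq_mul, mul_comm]
    rw [← h1]
    refine integral_mono_ae ((M.memLp_kernel μ hx).sub (M.memLp_kernel ν hx)).integrable_sq
      (integrable_const _) ?_
    filter_upwards [M.ae_mem, M.ae_abs_ratio_le] with y hy hr
    rw [← sq_abs]
    exact pow_le_pow_left₀ (abs_nonneg _) (M.abs_kernel_sub_le hμν hx hy hr) 2

theorem continuousAt_solOp {μ : ℝ} (hμ : μ ≠ 0) : ContinuousAt M.solOp μ := by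
  rw [ContinuousAt, tendsto_iff_norm_sub_tendsto_zero]
  have hlim : Filter.Tendsto (fun ν => |(|ν|⁻¹ - |μ|⁻¹)| * M.weight.real univ) (nhds μ)
      (nhds 0) := by
    have hc : ContinuousAt (fun ν : ℝ => |(|ν|⁻¹ - |μ|⁻¹)| * M.weight.real univ) μ := by
      have : |μ| ≠ 0 := abs_ne_zero.2 hμ
      fun_prop (disch := assumption)
    simpa [ContinuousAt] using hc
  refine squeeze_zero' (Filter.Eventually.of_forall fun _ => norm_nonneg _) ?_ hlim
  have hpos : ∀ᶠ ν in nhds μ, 0 < ν * μ := by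
    have hc : ContinuousAt (fun ν : ℝ => ν * μ) μ := by fun_prop
    exact hc.eventually (lt_mem_nhds (mul_self_pos.2 hμ))
  filter_upwards [hpos] with ν hν using M.norm_solOp_sub_le hν

theorem stronglyMeasurable_solOp : StronglyMeasurable M.solOp := by
  refine stronglyMeasurable_of_stronglyMeasurable_union_cover {0}ᶜ {0}
    (measurableSet_singleton 0).compl (measurableSet_singleton 0)
    (compl_union_self _).ge ?_ ?_
  · refine Continuous.stronglyMeasurable (continuous_iff_continuousAt.2 fun μ => ?_)
    exact (M.continuousAt_solOp μ.2).comp continuousAt_subtype_val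
  · exact stronglyMeasurable_const' fun x y => by rw [Subsingleton.elim x y]

theorem integrableOn_solOp {s : Set ℝ} (hs : volume s ≠ ∞) :
    IntegrableOn M.solOp s volume :=
  Measure.integrableOn_of_bounded (M := 2) hs M.stronglyMeasurable_solOp.aestronglyMeasurable
    (Filter.Eventually.of_forall M.norm_solOp_le)

end Slab

theorem integrableOn_sqrt_inv_abs :
    IntegrableOn (fun μ : ℝ => Real.sqrt |μ|⁻¹) (Icc (-1) 1) volume := by
  have h1 : IntegrableOn (fun μ : ℝ => Real.sqrt |μ|⁻¹) (Ioc 0 1) volume := by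
    have h := intervalIntegral.intervalIntegrable_rpow' (a := 0) (b := 1)
      (by norm_num : (-1 : ℝ) < -(1 / 2))
    rw [intervalIntegrable_iff_integrableOn_Ioc_of_le zero_le_one] at h
    refine h.congr_fun (fun μ hμ => ?_) measurableSet_Ioc
    simp only [abs_of_pos hμ.1]
    rw [Real.sqrt_eq_rpow, Real.inv_rpow hμ.1.le, Real.rpow_neg hμ.1.le]
  have h2 : IntegrableOn (fun μ : ℝ => Real.sqrt |μ|⁻¹) (Ico (-1) 0) volume := by
    have h := (MeasurePreserving.integrableOn_comp_preimage (Measure.measurePreserving_neg volume)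
      (Homeomorph.neg ℝ).measurableEmbedding).2 h1
    simpa [Function.comp_def] using! h
  have h3 : IntegrableOn (fun μ : ℝ => Real.sqrt |μ|⁻¹) {0} volume := by simp
  refine ((h1.union h2).union h3).mono_set fun μ hμ => ?_
  rcases lt_trichotomy μ 0 with h | h | h
  · exact Or.inl (Or.inr ⟨hμ.1, h⟩)
  · exact Or.inr h
  · exact Or.inl (Or.inl ⟨h, hμ.2⟩)

/-- Averages of `A_μ` are Hilbert-Schmidt operators, by Minkowski's inequality for the norm of
`hsEval s`, even if the set of velocities accumulates at 0. -/
theorem Slab.norm_hsEval_setAverage_le (M : Slab) {t : Set ℝ} (ht : t ⊆ Icc (-1) 1)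
    (s : Finset (basisSet M.L2)) :
    ‖hsEval s (⨍ μ in t, M.solOp μ)‖ ≤ (volume.real t)⁻¹ *
      (Real.sqrt (2 * M.weight.real univ) * ∫ μ in Icc (-1) 1, Real.sqrt |μ|⁻¹) := by
  have hfin : volume t ≠ ∞ := ((measure_mono ht).trans_lt (by simp)).ne
  rw [setAverage_eq, map_smul, norm_smul, norm_inv, Real.norm_of_nonneg measureReal_nonneg,
    ← ContinuousLinearMap.integral_comp_comm _ (M.integrableOn_solOp hfin), ← integral_const_mul]
  refine mul_le_mul_of_nonneg_left ?_ (by positivity)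
  have hi : IntegrableOn (fun μ : ℝ => Real.sqrt (2 * M.weight.real univ) * Real.sqrt |μ|⁻¹)
      (Icc (-1) 1) volume := integrableOn_sqrt_inv_abs.const_mul _
  refine (norm_integral_le_of_norm_le (hi.mono_set ht)
    (Filter.Eventually.of_forall fun μ => M.norm_hsEval_solOp_le μ s)).trans ?_
  exact setIntegral_mono_set hi (Filter.Eventually.of_forall fun μ => by positivity)
    ht.eventuallyLE

/-! ### The cells of the velocity space -/

section Cells

variable {m : ℕ} {δ : ℝ} {S : Fin m → Set ℝ}

theorem rev_castAdd_self (l : Fin m) : (Fin.castAdd m l).rev = Fin.natAdd m l.rev := by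
  ext
  simp only [Fin.val_rev, Fin.val_castAdd, Fin.val_natAdd]
  omega

theorem allCells_castAdd (S : Fin m → Set ℝ) (l : Fin m) : allCells S (Fin.castAdd m l) = S l := by
  simp [allCells]

theorem allCells_natAdd (S : Fin m → Set ℝ) (l : Fin m) :
    allCells S (Fin.natAdd m l) = Neg.neg ⁻¹' S l.rev := by
  rw [allCells, Fin.addCases_right]
  rfl

theorem allOrdinates_castAdd (u : Fin m → ℝ) (l : Fin m) :
    allOrdinates u (Fin.castAdd m l) = u l := by
  simp [allOrdinates]

theorem allOrdinates_rev (u : Fin m → ℝ) (l : Fin m) :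
    allOrdinates u (Fin.castAdd m l).rev = -u l := by
  rw [rev_castAdd_self, allOrdinates, Fin.addCases_right, Fin.rev_rev]

theorem allCells_rev (S : Fin m → Set ℝ) (l : Fin m) :
    allCells S (Fin.castAdd m l).rev = Neg.neg ⁻¹' S l := by
  rw [rev_castAdd_self, allCells_natAdd, Fin.rev_rev]

theorem velocity_subset (hδ0 : 0 ≤ δ) : velocity δ ⊆ Icc (-1) 1 := by
  rintro x (hx | hx)
  · exact ⟨hx.1, by linarith [hx.2]⟩
  · exact ⟨by linarith [hx.1], hx.2⟩

theorem IsPartition.subset (hS : IsPartition δ S) (l : Fin m) : S l ⊆ Ico (-1) (-δ) := by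
  rw [← hS.iUnion_eq]
  exact subset_iUnion S l

theorem IsPartition.measurableSet_allCells (hS : IsPartition δ S) (l : Fin (m + m)) :
    MeasurableSet (allCells S l) := by
  induction l using Fin.addCases with
  | left l => rw [allCells_castAdd]; exact hS.measurableSet l
  | right l => rw [allCells_natAdd]; exact measurable_neg (hS.measurableSet l.rev)

theorem IsPartition.volume_allCells_pos (hS : IsPartition δ S) (l : Fin (m + m)) :
    0 < volume (allCells S l) := by
  induction l using Fin.addCases with
  | left l => rw [allCells_castAdd]; exact hS.volume_pos l
  | right l => rw [allCells_natAdd, Measure.measure_preimage_neg]; exact hS.volume_pos l.rev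

theorem IsPartition.pairwise_disjoint_allCells (hδ0 : 0 ≤ δ) (hS : IsPartition δ S) :
    Pairwise fun k l => Disjoint (allCells S k) (allCells S l) := by
  have hmix : ∀ k l, Disjoint (S k) (Neg.neg ⁻¹' S l) := fun k l =>
    Set.disjoint_left.2 fun x hx hx' => by
      have h1 := (hS.subset k hx).2
      have h2 := (hS.subset l hx').2
      linarith
  intro k l hkl
  induction k using Fin.addCases with
  | left k =>
    induction l using Fin.addCases with
    | left l =>
      rw [allCells_castAdd, allCells_castAdd]
      exact hS.pairwise_disjoint fun h => hkl (h ▸ rfl)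
    | right l =>
      rw [allCells_castAdd, allCells_natAdd]
      exact hmix k _
  | right k =>
    induction l using Fin.addCases with
    | left l =>
      rw [allCells_castAdd, allCells_natAdd]
      exact (hmix l _).symm
    | right l =>
      rw [allCells_natAdd, allCells_natAdd]
      exact (hS.pairwise_disjoint fun h => hkl (by rw [Fin.rev_injective h])).preimage _

theorem IsPartition.iUnion_allCells (hS : IsPartition δ S) :
    ⋃ l, allCells S l = velocity δ := by
  have h1 : ⋃ l, Neg.neg ⁻¹' S l = Ioc δ 1 := by
    rw [← preimage_iUnion, hS.iUnion_eq]
    ext x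
    simp only [mem_preimage, mem_Ico, mem_Ioc]
    constructor <;> rintro ⟨h, h'⟩ <;> constructor <;> linarith
  rw [velocity, ← h1, ← hS.iUnion_eq]
  ext x
  simp only [mem_iUnion, mem_union]
  constructor
  · rintro ⟨l, hl⟩
    induction l using Fin.addCases with
    | left l => rw [allCells_castAdd] at hl; exact Or.inl ⟨l, hl⟩
    | right l => rw [allCells_natAdd] at hl; exact Or.inr ⟨l.rev, hl⟩
  · rintro (⟨l, hl⟩ | ⟨l, hl⟩)
    · exact ⟨Fin.castAdd m l, by rwa [allCells_castAdd]⟩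
    · exact ⟨(Fin.castAdd m l).rev, by rwa [allCells_rev]⟩

theorem IsPartition.allCells_subset (hδ0 : 0 ≤ δ) (hS : IsPartition δ S)
    (l : Fin (m + m)) : allCells S l ⊆ Icc (-1) 1 :=
  ((subset_iUnion (allCells S) l).trans_eq hS.iUnion_allCells).trans (velocity_subset hδ0)

theorem volume_ne_top_of_subset {t : Set ℝ} (ht : t ⊆ Icc (-1) 1) : volume t ≠ ∞ :=
  ((measure_mono ht).trans_lt (by simp)).ne

end Cells

/-! ### The cell operators as functions of one ordinate -/

section CellOperators

variable (M : Slab) {m : ℕ} (δ : ℝ) (S : Fin m → Set ℝ)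

/-- The operator `δT_l^ξ` as a function of the single ordinate `μ_l` on which it depends. -/
noncomputable def cellOp (l : Fin m) (v : ℝ) : M.L2 →L[ℝ] M.L2 :=
  (1 / 2 : ℝ) •
    (alpha δ S (Fin.castAdd m l) • M.solOp v - opTCell M δ S (Fin.castAdd m l)
      + alpha δ S (Fin.castAdd m l).rev • M.solOp (-v) - opTCell M δ S (Fin.castAdd m l).rev)

theorem deltaTCell_eq_cellOp (u : Fin m → ℝ) (l : Fin m) :
    deltaTCell M δ S u l = cellOp M δ S l (u l) := by
  rw [deltaTCell, cellOp, opTCellXi, opTCellXi, allOrdinates_castAdd, allOrdinates_rev]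

theorem stronglyMeasurable_cellOp (l : Fin m) : StronglyMeasurable (cellOp M δ S l) := by
  have h := M.stronglyMeasurable_solOp
  have h' : StronglyMeasurable fun v => M.solOp (-v) := h.comp_measurable measurable_neg
  exact ((((h.const_smul (alpha δ S (Fin.castAdd m l))).sub stronglyMeasurable_const).add
    (h'.const_smul (alpha δ S (Fin.castAdd m l).rev))).sub stronglyMeasurable_const).const_smul
      (1 / 2 : ℝ)

theorem exists_norm_cellOp_le : ∃ K : ℝ, ∀ l v, ‖cellOp M δ S l v‖ ≤ K := by
  have h : ∀ l, ∃ K : ℝ, ∀ v, ‖cellOp M δ S l v‖ ≤ K := by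
    intro l
    refine ⟨‖(1 / 2 : ℝ)‖ * (‖alpha δ S (Fin.castAdd m l)‖ * 2 + ‖opTCell M δ S (Fin.castAdd m l)‖
      + ‖alpha δ S (Fin.castAdd m l).rev‖ * 2 + ‖opTCell M δ S (Fin.castAdd m l).rev‖),
      fun v => ?_⟩
    rw [cellOp, norm_smul]
    refine mul_le_mul_of_nonneg_left ?_ (norm_nonneg _)
    refine norm_sub_le_of_le (norm_add_le_of_le (norm_sub_le_of_le ?_ le_rfl) ?_) le_rfl
    · rw [norm_smul]
      exact mul_le_mul_of_nonneg_left (M.norm_solOp_le v) (norm_nonneg _)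
    · rw [norm_smul]
      exact mul_le_mul_of_nonneg_left (M.norm_solOp_le (-v)) (norm_nonneg _)
  choose K hK using h
  refine ⟨∑ l, |K l|, fun l v => (hK l v).trans ((le_abs_self _).trans ?_)⟩
  exact Finset.single_le_sum (f := fun l => |K l|) (fun l _ => abs_nonneg _) (Finset.mem_univ l)

variable {M δ S}

/-- The Hilbert-Schmidt norm of `δT_l^ξ` is at most of order `|μ_l|^(-1/2)`. -/
theorem IsPartition.exists_norm_hsEval_cellOp_le (hδ0 : 0 ≤ δ)
    (hS : IsPartition δ S) (l : Fin m) : ∃ C D : ℝ, 0 ≤ C ∧ 0 ≤ D ∧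
      ∀ v s, ‖hsEval s (cellOp M δ S l v)‖ ≤ C * Real.sqrt |v|⁻¹ + D := by
  set W := Real.sqrt (2 * M.weight.real univ) with hW
  set I := ∫ μ in Icc (-1 : ℝ) 1, Real.sqrt |μ|⁻¹ with hI
  have hI0 : 0 ≤ I := integral_nonneg fun μ => Real.sqrt_nonneg _
  let D : Fin (m + m) → ℝ := fun k => ‖alpha δ S k‖ * ((volume.real (allCells S k))⁻¹ * (W * I))
  have hD : ∀ k s, ‖hsEval s (opTCell M δ S k)‖ ≤ D k := by
    intro k s
    rw [opTCell, map_smul, norm_smul]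
    exact mul_le_mul_of_nonneg_left
      (M.norm_hsEval_setAverage_le (hS.allCells_subset hδ0 k) s) (norm_nonneg _)
  have hA : ∀ k v s, ‖hsEval s (alpha δ S k • M.solOp v)‖ ≤
      ‖alpha δ S k‖ * (W * Real.sqrt |v|⁻¹) := by
    intro k v s
    rw [map_smul, norm_smul]
    exact mul_le_mul_of_nonneg_left (M.norm_hsEval_solOp_le v s) (norm_nonneg _)
  refine ⟨1 / 2 * (‖alpha δ S (Fin.castAdd m l)‖ * W + ‖alpha δ S (Fin.castAdd m l).rev‖ * W),
    1 / 2 * (D (Fin.castAdd m l) + D (Fin.castAdd m l).rev), by positivity, by positivity,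
    fun v s => ?_⟩
  have h := norm_sub_le_of_le (norm_add_le_of_le (norm_sub_le_of_le (hA (Fin.castAdd m l) v s)
    (hD (Fin.castAdd m l) s)) (hA (Fin.castAdd m l).rev (-v) s)) (hD (Fin.castAdd m l).rev s)
  rw [abs_neg] at h
  rw [cellOp, map_smul, norm_smul, map_sub, map_add, map_sub, Real.norm_of_nonneg (by norm_num)]
  refine (mul_le_mul_of_nonneg_left h (by norm_num)).trans_eq ?_
  ring

theorem opT_eq_average (hm : 1 ≤ m) (hδ0 : 0 ≤ δ) (hS : IsPartition δ S) :
    opT M δ = (1 / ((m + m : ℕ) : ℝ)) • ∑ l, opTCell M δ S l := by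
  have hm0 : ((m + m : ℕ) : ℝ) ≠ 0 := by
    have : m + m ≠ 0 := by omega
    exact_mod_cast this
  have hfin : ∀ l, volume (allCells S l) ≠ ∞ := fun l =>
    volume_ne_top_of_subset (hS.allCells_subset hδ0 l)
  rw [opT, setAverage_eq, ← hS.iUnion_allCells,
    integral_iUnion_fintype hS.measurableSet_allCells (hS.pairwise_disjoint_allCells hδ0)
      fun l => M.integrableOn_solOp (hfin l), Finset.smul_sum, Finset.smul_sum]
  refine Finset.sum_congr rfl fun l _ => ?_
  have hc : volume.real (allCells S l) ≠ 0 :=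
    (ENNReal.toReal_pos (hS.volume_allCells_pos l).ne' (hfin l)).ne'
  rw [opTCell, setAverage_eq, smul_smul, smul_smul, alpha, hS.iUnion_allCells]
  congr 1
  field_simp

theorem deltaT_eq_average (hm : 1 ≤ m) (hδ0 : 0 ≤ δ) (hS : IsPartition δ S)
    (u : Fin m → ℝ) : deltaT M δ S u = (1 / (m : ℝ)) • ∑ l, deltaTCell M δ S u l := by
  have hm0 : (m : ℝ) ≠ 0 := by
    have : m ≠ 0 := by omega
    exact_mod_cast this
  have h1 : deltaT M δ S u = (1 / ((m + m : ℕ) : ℝ)) •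
      ∑ l, (opTCellXi M δ S u l - opTCell M δ S l) := by
    rw [deltaT, opT_eq_average hm hδ0 hS, opTXi, ← smul_sub, ← Finset.sum_sub_distrib]
    rfl
  have h2 : ∀ g : Fin (m + m) → (M.L2 →L[ℝ] M.L2), ∑ l, g l =
      ∑ l : Fin m, (g (Fin.castAdd m l) + g (Fin.castAdd m l).rev) := by
    intro g
    rw [Fin.sum_univ_add, Finset.sum_add_distrib]
    congr 1
    rw [← Equiv.sum_comp Fin.revPerm]
    simp only [rev_castAdd_self, Fin.revPerm_apply]
  rw [h1, h2, Finset.smul_sum, Finset.smul_sum]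
  refine Finset.sum_congr rfl fun l _ => ?_
  rw [deltaTCell, smul_smul, add_sub_assoc]
  congr 1
  push_cast
  field_simp
  norm_num

variable {Ω : Type*} [MeasurableSpace Ω] {P : Measure Ω}

theorem integral_comp_of_isUniform {E : Type*} [NormedAddCommGroup E] [NormedSpace ℝ E]
    {X : Ω → ℝ} (hX : Measurable X) {t : Set ℝ} (hXt : pdf.IsUniform X t P volume) {f : ℝ → E}
    (hf : StronglyMeasurable f) : ∫ ω, f (X ω) ∂P = ⨍ v in t, f v := by
  rw [← integral_map hX.aemeasurable hf.aestronglyMeasurable, hXt, setAverage_eq']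
  rfl

theorem integral_smul_affine [IsProbabilityMeasure P] {E : Type*} [NormedAddCommGroup E]
    [NormedSpace ℝ E] [CompleteSpace E] {f g : Ω → E} (hf : Integrable f P) (hg : Integrable g P)
    (r a b : ℝ) (p q : E) : ∫ ω, r • (a • f ω - p + b • g ω - q) ∂P =
      r • (a • ∫ ω, f ω ∂P - p + b • ∫ ω, g ω ∂P - q) := by
  have hf' : Integrable (fun ω => a • f ω) P := hf.smul a
  have hg' : Integrable (fun ω => b • g ω) P := hg.smul b
  have h1 : Integrable (fun ω => a • f ω - p) P := hf'.sub (integrable_const p)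
  rw [integral_smul, integral_sub (h1.fun_add hg') (integrable_const q), integral_add h1 hg',
    integral_sub hf' (integrable_const p), integral_smul, integral_smul]
  simp

theorem integral_cellOp_eq_zero [IsProbabilityMeasure P] {l : Fin m} {X : Ω → ℝ} (hX : Measurable X)
    (hXS : pdf.IsUniform X (S l) P volume) : ∫ ω, cellOp M δ S l (X ω) ∂P = 0 := by
  have hm := M.stronglyMeasurable_solOp
  have hmneg : StronglyMeasurable fun v => M.solOp (-v) := hm.comp_measurable measurable_neg
  have hi : Integrable (fun ω => M.solOp (X ω)) P :=
    Integrable.of_bound (hm.comp_measurable hX).aestronglyMeasurable 2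
      (Filter.Eventually.of_forall fun ω => M.norm_solOp_le _)
  have hi' : Integrable (fun ω => M.solOp (-X ω)) P :=
    Integrable.of_bound (hmneg.comp_measurable hX).aestronglyMeasurable 2
      (Filter.Eventually.of_forall fun ω => M.norm_solOp_le _)
  have h1 : ∫ ω, M.solOp (X ω) ∂P = ⨍ v in allCells S (Fin.castAdd m l), M.solOp v := by
    rw [integral_comp_of_isUniform hX hXS hm, allCells_castAdd]
  have h2 : ∫ ω, M.solOp (-X ω) ∂P = ⨍ v in allCells S (Fin.castAdd m l).rev, M.solOp v := by
    rw [integral_comp_of_isUniform hX hXS hmneg, allCells_rev, setAverage_eq, setAverage_eq,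
      measureReal_def, measureReal_def, Measure.measure_preimage_neg,
      ← (Measure.measurePreserving_neg (volume : Measure ℝ)).setIntegral_preimage_emb
        (Homeomorph.neg ℝ).measurableEmbedding M.solOp, ← preimage_comp]
    congr 2
    simp
  unfold cellOp
  rw [integral_smul_affine hi hi', h1, h2]
  simp [opTCell]

theorem integrable_sqrt_inv_abs_of_isUniform {X : Ω → ℝ} (hX : Measurable X) {t : Set ℝ}
    (ht : t ⊆ Icc (-1) 1) (hpos : 0 < volume t) (hXt : pdf.IsUniform X t P volume) :
    Integrable (fun ω => Real.sqrt |X ω|⁻¹) P := by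
  have hg : Measurable fun v : ℝ => Real.sqrt |v|⁻¹ := by fun_prop
  have h : Integrable (fun v : ℝ => Real.sqrt |v|⁻¹) (P.map X) := by
    rw [hXt]
    exact (integrableOn_sqrt_inv_abs.mono_set ht).smul_measure (ENNReal.inv_ne_top.2 hpos.ne')
  exact (integrable_map_measure hg.aestronglyMeasurable hX.aemeasurable).1 h

end CellOperators

/-- The function `v ↦ v log (t / v)` is dominated by the geometric mean of `t` and `v`. -/
theorem abs_log_div_add_mul_le {t v : ℝ} (hv : 0 ≤ v) (hvt : v ≤ t) :
    |(Real.log (t / v) + 2.7) * v| ≤ 2 * (Real.sqrt t * Real.sqrt v) + 2.7 * v := by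
  rcases hv.eq_or_lt with rfl | hv
  · simp
  have hX : 0 ≤ Real.log (t / v) := Real.log_nonneg ((one_le_div hv).2 hvt)
  have ht : 0 < t := hv.trans_le hvt
  rw [abs_of_nonneg (by positivity), add_mul]
  refine add_le_add_left ?_ _
  have h1 : Real.log (t / v) ≤ 2 * Real.sqrt (t / v) := by
    have h2 := Real.log_le_sub_one_of_pos (Real.sqrt_pos.2 (div_pos ht hv))
    rw [Real.log_sqrt (div_pos ht hv).le] at h2
    linarith
  calc Real.log (t / v) * v ≤ 2 * Real.sqrt (t / v) * v := by gcongr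
    _ = 2 * (Real.sqrt t * Real.sqrt v) := by
        rw [Real.sqrt_div ht.le]
        nth_rewrite 2 [← Real.mul_self_sqrt hv.le]
        have := (Real.sqrt_pos.2 hv).ne'
        field_simp

/-! ### The variance bound -/

section Final

variable {M : Slab} {m : ℕ} {δ : ℝ} {S : Fin m → Set ℝ}
variable {Ω : Type*} [MeasurableSpace Ω] {P : Measure Ω}

theorem traceCell_eq_cellOp (u : Fin m → ℝ) (l : Fin m) : traceCell M δ S u l =
    posTrace (ContinuousLinearMap.adjoint (cellOp M δ S l (u l)) ∘L cellOp M δ S l (u l)) := by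
  rw [traceCell, deltaTCell_eq_cellOp]

theorem traceCell_ne_top (hδ0 : 0 ≤ δ) (hS : IsPartition δ S) (u : Fin m → ℝ) (l : Fin m) :
    traceCell M δ S u l ≠ ∞ := by
  obtain ⟨C, D, -, -, h⟩ := hS.exists_norm_hsEval_cellOp_le (M := M) hδ0 l
  rw [traceCell_eq_cellOp]
  exact ((posTrace_le_of_norm_hsEval_le fun s => h (u l) s).trans_lt ENNReal.ofReal_lt_top).ne

theorem norm_deltaTCell_sq_le_traceCell (hδ0 : 0 ≤ δ) (hS : IsPartition δ S) (u : Fin m → ℝ)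
    (l : Fin m) : ‖deltaTCell M δ S u l‖ ^ 2 ≤ (traceCell M δ S u l).toReal :=
  (ENNReal.ofReal_le_iff_le_toReal (traceCell_ne_top hδ0 hS u l)).1
    (ofReal_norm_sq_le_posTrace _)

theorem measurable_traceCell {μ : Fin m → Ω → ℝ} (hmeas : ∀ l, Measurable (μ l)) (l : Fin m) :
    Measurable fun ω => traceCell M δ S (fun k => μ k ω) l := by
  simp_rw [traceCell_eq_cellOp]
  -- The space of operators is not separable, so the measurability of the trace is derived from
  -- its lower semicontinuity.
  borelize (M.L2 →L[ℝ] M.L2)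
  exact lowerSemicontinuous_posTrace.measurable.comp
    ((stronglyMeasurable_cellOp M δ S l).measurable.comp (hmeas l))

theorem measurable_norm_deltaTCell {μ : Fin m → Ω → ℝ} (hmeas : ∀ l, Measurable (μ l))
    (l : Fin m) : Measurable fun ω => ‖deltaTCell M δ S (fun k => μ k ω) l‖ := by
  simp_rw [deltaTCell_eq_cellOp]
  exact ((stronglyMeasurable_cellOp M δ S l).comp_measurable (hmeas l)).norm.measurable

/-- The square root of the total trace is dominated by a combination of the functions
`|μ_l|^(-1/2)`, which stay integrable when the velocity space is not truncated; the trace itself is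
only of order `|μ_l|⁻¹`. -/
theorem exists_sqrt_sum_traceCell_le (hδ0 : 0 ≤ δ) (hS : IsPartition δ S) :
    ∃ C D : Fin m → ℝ, ∀ u : Fin m → ℝ, Real.sqrt (∑ l, (traceCell M δ S u l).toReal) ≤
      ∑ l, (C l * Real.sqrt |u l|⁻¹ + D l) := by
  choose C D hC hD h using fun l => hS.exists_norm_hsEval_cellOp_le (M := M) hδ0 l
  refine ⟨C, D, fun u => ?_⟩
  have h0 : ∀ l, 0 ≤ C l * Real.sqrt |u l|⁻¹ + D l := fun l =>
    add_nonneg (mul_nonneg (hC l) (Real.sqrt_nonneg _)) (hD l)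
  refine Real.sqrt_le_iff.2 ⟨Finset.sum_nonneg fun l _ => h0 l, ?_⟩
  refine (Finset.sum_le_sum fun l _ => ?_).trans
    (Finset.sum_sq_le_sq_sum_of_nonneg fun l _ => h0 l)
  rw [traceCell_eq_cellOp]
  exact ENNReal.toReal_le_of_le_ofReal (sq_nonneg _)
    (posTrace_le_of_norm_hsEval_le fun s => h l (u l) s)

theorem integrable_log_mul [IsFiniteMeasure P] (hδ0 : 0 ≤ δ) (hS : IsPartition δ S) {μ : Fin m → Ω → ℝ}
    (hmeas : ∀ l, Measurable (μ l)) (hunif : ∀ l, pdf.IsUniform (μ l) (S l) P volume) :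
    Integrable (fun ω => (Real.log ((∑ l, (traceCell M δ S (fun k => μ k ω) l).toReal) /
      ∑ l, ‖deltaTCell M δ S (fun k => μ k ω) l‖ ^ 2) + 2.7) *
        ∑ l, ‖deltaTCell M δ S (fun k => μ k ω) l‖ ^ 2) P := by
  obtain ⟨K, hK⟩ := exists_norm_cellOp_le M δ S
  obtain ⟨C, D, hCD⟩ := exists_sqrt_sum_traceCell_le (M := M) hδ0 hS
  have hmT : Measurable fun ω => ∑ l, (traceCell M δ S (fun k => μ k ω) l).toReal :=
    Finset.measurable_fun_sum _ fun l _ => (measurable_traceCell hmeas l).ennreal_toReal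
  have hmN : Measurable fun ω => ∑ l, ‖deltaTCell M δ S (fun k => μ k ω) l‖ ^ 2 :=
    Finset.measurable_fun_sum _ fun l _ => (measurable_norm_deltaTCell hmeas l).pow_const 2
  set V : ℝ := ∑ _l : Fin m, K ^ 2 with hV
  have hdom : Integrable (fun ω => 2 * ((∑ l, (C l * Real.sqrt |μ l ω|⁻¹ + D l)) * Real.sqrt V) +
      2.7 * V) P := by
    refine (((integrable_finsetSum _ fun l _ => ?_).mul_const _).const_mul 2).add
      (integrable_const _)
    have hsub : S l ⊆ Icc (-1) 1 := fun x hx =>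
      ⟨(hS.subset l hx).1, by linarith [(hS.subset l hx).2]⟩
    exact ((integrable_sqrt_inv_abs_of_isUniform (hmeas l) hsub
      (hS.volume_pos l) (hunif l)).const_mul _).add (integrable_const _)
  refine hdom.mono' (by fun_prop) (Filter.Eventually.of_forall fun ω => ?_)
  have hv0 : 0 ≤ ∑ l, ‖deltaTCell M δ S (fun k => μ k ω) l‖ ^ 2 :=
    Finset.sum_nonneg fun l _ => sq_nonneg _
  have hvV : ∑ l, ‖deltaTCell M δ S (fun k => μ k ω) l‖ ^ 2 ≤ V := by
    refine Finset.sum_le_sum fun l _ => ?_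
    rw [deltaTCell_eq_cellOp]
    exact pow_le_pow_left₀ (norm_nonneg _) (hK l _) 2
  have hvt := Finset.sum_le_sum fun l (_ : l ∈ Finset.univ) =>
    norm_deltaTCell_sq_le_traceCell (M := M) hδ0 hS (fun k => μ k ω) l
  refine (abs_log_div_add_mul_le hv0 hvt).trans ?_
  have hC := hCD fun k => μ k ω
  gcongr
  exact (Real.sqrt_nonneg _).trans hC

/-- Symmetrization costs a factor 4 for each choice of signs; averaging over the signs and applying
the Rademacher bound at each outcome costs a factor 2. -/
theorem integral_norm_sum_deltaTCell_sq_le [IsProbabilityMeasure P] (hδ0 : 0 ≤ δ) (hS : IsPartition δ S)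
    {μ : Fin m → Ω → ℝ} (hmeas : ∀ l, Measurable (μ l)) (hindep : iIndepFun μ P)
    (hunif : ∀ l, pdf.IsUniform (μ l) (S l) P volume) :
    ∫ ω, ‖∑ l, deltaTCell M δ S (fun k => μ k ω) l‖ ^ 2 ∂P ≤
      8 * ∫ ω, (Real.log ((∑ l, (traceCell M δ S (fun k => μ k ω) l).toReal) /
      ∑ l, ‖deltaTCell M δ S (fun k => μ k ω) l‖ ^ 2) + 2.7) *
        ∑ l, ‖deltaTCell M δ S (fun k => μ k ω) l‖ ^ 2 ∂P := by
  obtain ⟨K, hK⟩ := exists_norm_cellOp_le M δ S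
  have hlog := integrable_log_mul (M := M) hδ0 hS hmeas hunif
  set X : Ω → ℝ := fun ω => (Real.log ((∑ l, (traceCell M δ S (fun k => μ k ω) l).toReal) /
      ∑ l, ‖deltaTCell M δ S (fun k => μ k ω) l‖ ^ 2) + 2.7) *
        ∑ l, ‖deltaTCell M δ S (fun k => μ k ω) l‖ ^ 2 with hX
  have hN : (0 : ℝ) < Fintype.card (Fin m → ℤˣ) := by exact_mod_cast Fintype.card_pos
  have hsymm : ∀ ε : Fin m → ℤˣ, ∫ ω, ‖∑ l, deltaTCell M δ S (fun k => μ k ω) l‖ ^ 2 ∂P ≤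
      4 * ∫ ω, ‖signedSum (fun l => deltaTCell M δ S (fun k => μ k ω) l) ε‖ ^ 2 ∂P := by
    intro ε
    simp_rw [deltaTCell_eq_cellOp]
    exact integral_norm_sum_sq_le hmeas hindep (stronglyMeasurable_cellOp M δ S) hK
      (fun l => integral_cellOp_eq_zero (hmeas l) (hunif l)) ε
  have hint : ∀ ε : Fin m → ℤˣ, Integrable
      (fun ω => ‖signedSum (fun l => deltaTCell M δ S (fun k => μ k ω) l) ε‖ ^ 2) P := by
    intro ε
    simp_rw [deltaTCell_eq_cellOp]
    have hsm : StronglyMeasurable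
        fun ω => signedSum (fun l => cellOp M δ S l (μ l ω)) ε := by
      unfold signedSum
      exact Finset.stronglyMeasurable_fun_sum _ fun l _ =>
        ((stronglyMeasurable_cellOp M δ S l).comp_measurable (hmeas l)).const_smul ((ε l : ℤ) : ℝ)
    refine Integrable.of_bound (hsm.norm.pow 2).aestronglyMeasurable ((∑ _l : Fin m, K) ^ 2)
      (Filter.Eventually.of_forall fun ω => ?_)
    rw [norm_pow, norm_norm]
    refine pow_le_pow_left₀ (norm_nonneg _) (norm_sum_le_of_le _ fun l _ => ?_) 2
    rw [norm_smul]
    have h1 : ‖((ε l : ℤ) : ℝ)‖ = 1 := by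
      rcases Int.units_eq_one_or (ε l) with h | h <;> simp [h]
    rw [h1, one_mul]
    exact hK l _
  have hsum : Fintype.card (Fin m → ℤˣ) *
      ∫ ω, ‖∑ l, deltaTCell M δ S (fun k => μ k ω) l‖ ^ 2 ∂P ≤
        Fintype.card (Fin m → ℤˣ) * (8 * ∫ ω, X ω ∂P) :=
    calc Fintype.card (Fin m → ℤˣ) * ∫ ω, ‖∑ l, deltaTCell M δ S (fun k => μ k ω) l‖ ^ 2 ∂P
        = ∑ _ε : Fin m → ℤˣ, ∫ ω, ‖∑ l, deltaTCell M δ S (fun k => μ k ω) l‖ ^ 2 ∂P := by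
          rw [Finset.sum_const, nsmul_eq_mul, Finset.card_univ]
      _ ≤ ∑ ε, 4 * ∫ ω, ‖signedSum (fun l => deltaTCell M δ S (fun k => μ k ω) l) ε‖ ^ 2 ∂P :=
          Finset.sum_le_sum fun ε _ => hsymm ε
      _ = 4 * ∫ ω, ∑ ε, ‖signedSum (fun l => deltaTCell M δ S (fun k => μ k ω) l) ε‖ ^ 2 ∂P := by
          rw [← Finset.mul_sum, integral_finsetSum _ fun ε _ => hint ε]
      _ ≤ 4 * ∫ ω, Fintype.card (Fin m → ℤˣ) * (2 * X ω) ∂P := by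
          refine mul_le_mul_of_nonneg_left ?_ (by norm_num)
          refine integral_mono (integrable_finsetSum _ fun ε _ => hint ε)
            ((hlog.const_mul 2).const_mul _) fun ω => ?_
          exact sum_norm_signedSum_sq_le fun l => traceCell_ne_top hδ0 hS (fun k => μ k ω) l
      _ = Fintype.card (Fin m → ℤˣ) * (8 * ∫ ω, X ω ∂P) := by
          rw [integral_const_mul, integral_const_mul]
          ring
  exact le_of_mul_le_mul_left hsum hN

end Final

end RandomOrdinate

theorem mainTheorem2 (M : Slab) (δ : ℝ) (hδ0 : 0 ≤ δ) (hδ1 : δ < 1)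
    (m : ℕ) (hm : 1 ≤ m) (S : Fin m → Set ℝ) (hS : IsPartition δ S)
    {Ω : Type*} [MeasurableSpace Ω] (P : Measure Ω) [IsProbabilityMeasure P]
    (μ : Fin m → Ω → ℝ) (hmeas : ∀ l, Measurable (μ l)) (hindep : iIndepFun μ P)
    (hunif : ∀ l, pdf.IsUniform (μ l) (S l) P volume) :
    (∀ ω, deltaT M δ S (fun k => μ k ω) =
      (1 / (m : ℝ)) • ∑ l, deltaTCell M δ S (fun k => μ k ω) l) ∧
    (∀ᵐ ω ∂P, ∀ l, traceCell M δ S (fun k => μ k ω) l < ∞) ∧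
    Integrable (fun ω => ‖deltaT M δ S (fun k => μ k ω)‖ ^ 2) P ∧
    Integrable (fun ω =>
      (Real.log (((1 / (m : ℝ)) * ∑ l, (traceCell M δ S (fun k => μ k ω) l).toReal) /
          ((1 / (m : ℝ)) * ∑ l, ‖deltaTCell M δ S (fun k => μ k ω) l‖ ^ 2)) + 2.7) *
        ((1 / (m : ℝ) ^ 2) * ∑ l, ‖deltaTCell M δ S (fun k => μ k ω) l‖ ^ 2)) P ∧
    ∫ ω, ‖deltaT M δ S (fun k => μ k ω)‖ ^ 2 ∂P ≤
      8 * ∫ ω,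
        (Real.log (((1 / (m : ℝ)) * ∑ l, (traceCell M δ S (fun k => μ k ω) l).toReal) /
            ((1 / (m : ℝ)) * ∑ l, ‖deltaTCell M δ S (fun k => μ k ω) l‖ ^ 2)) + 2.7) *
          ((1 / (m : ℝ) ^ 2) * ∑ l, ‖deltaTCell M δ S (fun k => μ k ω) l‖ ^ 2) ∂P := by
  have hm0 : (1 / (m : ℝ)) ≠ 0 := by
    have : m ≠ 0 := by omega
    positivity
  have hid : ∀ ω, deltaT M δ S (fun k => μ k ω) =
      (1 / (m : ℝ)) • ∑ l, deltaTCell M δ S (fun k => μ k ω) l := fun ω =>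
    deltaT_eq_average hm hδ0 hS _
  have hnorm : ∀ ω, ‖deltaT M δ S (fun k => μ k ω)‖ ^ 2 =
      1 / (m : ℝ) ^ 2 * ‖∑ l, deltaTCell M δ S (fun k => μ k ω) l‖ ^ 2 := by
    intro ω
    rw [hid, norm_smul, mul_pow, Real.norm_of_nonneg (by positivity), div_pow, one_pow]
  have hlog := integrable_log_mul (M := M) hδ0 hS hmeas hunif
  have hscale : ∀ ω, (Real.log (((1 / (m : ℝ)) * ∑ l, (traceCell M δ S (fun k => μ k ω) l).toReal) /
      ((1 / (m : ℝ)) * ∑ l, ‖deltaTCell M δ S (fun k => μ k ω) l‖ ^ 2)) + 2.7) *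
        ((1 / (m : ℝ) ^ 2) * ∑ l, ‖deltaTCell M δ S (fun k => μ k ω) l‖ ^ 2) =
      1 / (m : ℝ) ^ 2 * ((Real.log ((∑ l, (traceCell M δ S (fun k => μ k ω) l).toReal) /
        ∑ l, ‖deltaTCell M δ S (fun k => μ k ω) l‖ ^ 2) + 2.7) *
          ∑ l, ‖deltaTCell M δ S (fun k => μ k ω) l‖ ^ 2) := by
    intro ω
    rw [mul_div_mul_left _ _ hm0, mul_left_comm]
  refine ⟨hid, Filter.Eventually.of_forall fun ω l => (traceCell_ne_top hδ0 hS _ l).lt_top,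
    ?_, ?_, ?_⟩
  · obtain ⟨K, hK⟩ := exists_norm_cellOp_le M δ S
    simp_rw [hnorm, deltaTCell_eq_cellOp]
    have hsm : StronglyMeasurable fun ω => ∑ l, cellOp M δ S l (μ l ω) :=
      Finset.stronglyMeasurable_fun_sum _ fun l _ =>
        (stronglyMeasurable_cellOp M δ S l).comp_measurable (hmeas l)
    refine (Integrable.of_bound (hsm.norm.pow 2).aestronglyMeasurable ((∑ _l : Fin m, K) ^ 2)
      (Filter.Eventually.of_forall fun ω => ?_)).const_mul _
    rw [Pi.pow_apply, norm_pow, norm_norm]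
    exact pow_le_pow_left₀ (norm_nonneg _) (norm_sum_le_of_le _ fun l _ => hK l _) 2
  · simp_rw [hscale]
    exact hlog.const_mul _
  · simp_rw [hnorm, hscale]
    rw [integral_const_mul, integral_const_mul, mul_left_comm]
    exact mul_le_mul_of_nonneg_left
      (integral_norm_sum_deltaTCell_sq_le hδ0 hS hmeas hindep hunif) (by positivity)
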